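/- Let $n\ge 2$, let $K$ be a field of characteristic $0$ and let $q^{1/4}\in K$ be nonzero and not a root of unity (for instance $K=\mathbf C(q^{1/4})$). Write $[x]=\frac{q^{x}-q^{-x}}{q-q^{-1}}$ and $[A,B]_v=AB-v\,BA$, $[A,B]=[A,B]_1$. Lattice. Let $P=\bigoplus_{i=1}^n\mathbf Z\varepsilon_i$ with $(\varepsilon_i|\varepsilon_j)=\frac12\delta_{ij}$, $\alpha_i=\varepsilon_i-\varepsilon_{i+1}$ ($i<n$), $\alpha_n=2\varepsilon_n$, $\lambda_i=\varepsilon_1+\dots+\varepsilon_i$. Fock space. Let $a_i(m),b_i(m)$ ($1\le i\le n$, $m\ne 0$) satisfy $$[a_i(m),a_j(l)]=\delta_{m+l,0}\frac{[m(\alpha_i|\alpha_j)]\,[-m/2]}{m},\qquad [b_i(m),b_j(l)]=m\,\delta_{ij}\delta_{m+l,0},\qquad [a_i(m),b_j(l)]=0 ,$$ and let $\widetilde{\mathcal F}=\bigoplus \mathcal F_{\alpha,\beta}$ over $\alpha\in P+\frac12\mathbf Z\lambda_n$, $\beta\in P$, where $\mathcal F_{\alpha,\beta}$ is the Fock space freely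 generated by the $a_i(-m),b_i(-m)$, $m>0$, from a vacuum $|\alpha,\beta\rangle$ killed by $a_i(m),b_i(m)$, $m>0$. On $\mathcal F_{\alpha,\beta}$ put $a_i(0)=(\alpha_i|\alpha)$, $b_i(0)=(2\varepsilon_i|\beta)$. For $\gamma\in P$ the operator $e^{\gamma}$ maps $|\alpha,\beta\rangle$ to $|\alpha+\gamma,\beta\rangle$, $e^{b_i}$ maps it to $|\alpha,\beta+\varepsilon_i\rangle$, and both commute with all modes of nonzero index. Currents. Put $\partial f(z)=\frac{f(q^{1/2}z)-f(q^{-1/2}z)}{(q^{1/2}-q^{-1/2})z}$, $$Y_i^{\pm}(z)=\exp\Bigl(\pm\sum_{k\ge1}\tfrac{a_i(-k)}{[-k/2]}q^{\pm k/4}z^k\Bigr)\exp\Bigl(\mp\sum_{k\ge1}\tfrac{a_i(k)}{[-k/2]}q^{\pm k/4}z^{-k}\Bigr)e^{\pm\alpha_i}z^{\mp2a_i(0)},$$ $$Z_i^{\pm}(z)=\exp\Bigl(\pm\sum_{k\ge1}\tfrac{b_i(-k)}{k}z^k\Bigr)\exp\Bigl(\mp\sum_{k\ge1}\tfrac{b_i(k)}{k}z^{-k}\Bigr)e^{\pm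 b_i}z^{\pm b_i(0)},$$ and, with $:\ :$ the normal ordering (creation operators and $e^{\gamma}$ to the left), $$X_i^+(z)=\partial Z_i^+(z)\,Z_{i+1}^-(z)\,Y_i^+(z),\qquad X_i^-(z)=Z_i^-(z)\,\partial Z_{i+1}^+(z)\,Y_i^-(z)\qquad(1\le i\le n-1),$$ $$X_n^+(z)=\Bigl(\tfrac1{q^{1/2}+q^{-1/2}}:Z_n^+(z)\partial^2Z_n^+(z):-:\partial Z_n^+(q^{1/2}z)\,\partial Z_n^+(q^{-1/2}z):\Bigr)Y_n^+(z),$$ $$X_n^-(z)=\tfrac1{q^{1/2}+q^{-1/2}}:Z_n^-(q^{1/2}z)Z_n^-(q^{-1/2}z):Y_n^-(z).$$ Write $X_i^\pm(z)=\sum_{m\in\mathbf Z}x_i^\pm(m)z^{-m-1}$. Vertex operator. For $m\neq0$ let $$a_{\bar1}(m)=\sum_{i=1}^{n-1}\frac{m}{[m/2]^2}\,\frac{[(n+1-i)m]}{[(n+1-i)m/2]}\,\frac{[(n+1)m/2]}{[(n+1)m]}\,a_i(m)+\frac{m}{[m/2]^2}\,\frac{[(n+1)m/2]}{[(n+1)m]}\,a_n(m),$$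 the combination with $[a_j(m),a_{\bar1}(l)]=\delta_{j1}\delta_{m,-l}$. Let $\mu$ be one of the classical weights $0$, $\lambda_1$, $-\frac12\lambda_n$, $-\frac32\lambda_n+\lambda_{n-1}$ (the classical parts of $\mu_1,\dots,\mu_4$), let $c\in K$ be a constant, let $\lambda_1(0)$ act on $\mathcal F_{\alpha,\beta}$ as $2(\lambda_1|\alpha)$, and let $$\Phi_{\bar1}(z)=c\,\exp\Bigl(\sum_{k\ge1}\tfrac{[k/2]}{k}q^{(n+1/4)k}a_{\bar1}(-k)z^k\Bigr)\exp\Bigl(\sum_{k\ge1}\tfrac{[k/2]}{k}q^{-(n+3/4)k}a_{\bar1}(k)z^{-k}\Bigr)e^{\lambda_1}\,(q^{n+1/2}z)^{-\lambda_1(0)+1-2(\lambda_1|\mu)}\;\partial_z\bigl(Z_1^+(q^{n+1/2}z)\bigr),$$ a formal series in $z^{\pm1/2}$ of operators on $\widetilde{\mathcal F}$. Proposition. As formal series in $z,w$ with coefficients in $\operatorname{End}(\widetilde{\mathcal F})$: $$[\Phi_{\bar1}(z),X_i^+(w)]=0\quad(1\le i\le n),\qquad [\Phi_{\bar1}(z),X_i^-(w)]=0\quad(2\le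 i\le n),$$ $$[\Phi_{\bar1}(z),X_1^-(w)]_{q^{-1/2}}=\frac zw\,q^n\,[\Phi_{\bar1}(z),X_1^-(w)]_{q^{1/2}} .$$ In particular $$[\Phi_{\bar1}(z),x_1^-(1)]_{q^{-1/2}}=z\,q^n\,[\Phi_{\bar1}(z),x_1^-(0)]_{q^{1/2}} .$$ -/

import Mathlib

namespace SpVertex

noncomputable section

/-! ### Lattice data of type `C_n`

Indices of simple roots run through `1, …, n`; the coordinate `k : Fin n` corresponds to the index
`k + 1`.  Elements of `P = ℤ ε_1 ⊕ ⋯ ⊕ ℤ ε_n` are written in the basis `ε_1, …, ε_n`. -/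

/-- `ε_i`. -/
def eps (n i : ℕ) : Fin n → ℤ := fun k => if (k : ℕ) + 1 = i then 1 else 0

/-- The simple roots `α_i = ε_i - ε_{i+1}` for `i < n` and `α_n = 2 ε_n`. -/
def root (n i : ℕ) : Fin n → ℤ := if i < n then eps n i - eps n (i + 1) else 2 • eps n n

/-- `λ_i = ε_1 + ⋯ + ε_i`. -/
def fundWt (n i : ℕ) : Fin n → ℤ := ∑ j ∈ Finset.Icc 1 i, eps n j

/-- The inclusion of `P` into its rational span. -/
def toRat {n : ℕ} (x : Fin n → ℤ) : Fin n → ℚ := fun k => (x k : ℚ)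

/-- The bilinear form with `(ε_i | ε_j) = δ_{ij} / 2`. -/
def form {n : ℕ} (x y : Fin n → ℚ) : ℚ := ∑ k, x k * y k / 2

/-- Labels of the sectors of the Fock space: the pairs `(α, β)` with `α ∈ P + ½ ℤ λ_n`, `β ∈ P`.
The triple `(h, x, y)` stands for `α = x` (if `h = false`) or `α = x + ½ λ_n` (if `h = true`),
and `β = y`. -/
abbrev Charge (n : ℕ) := Bool × (Fin n → ℤ) × (Fin n → ℤ)

/-- The weight `α` of a sector. -/
def Charge.al {n : ℕ} (w : Charge n) : Fin n → ℚ :=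
  toRat w.2.1 + (if w.1 then (1 / 2 : ℚ) else 0) • toRat (fundWt n n)

/-- The weight `β` of a sector. -/
def Charge.be {n : ℕ} (w : Charge n) : Fin n → ℚ := toRat w.2.2

/-- The classical parts of the four highest weights `μ_1 = -½Λ_0`, `μ_2 = -3/2 Λ_0 + Λ_1 - ½ δ`,
`μ_3 = -½ Λ_n`, `μ_4 = -3/2 Λ_n + Λ_{n-1}` (numbered `0, 1, 2, 3`). -/
def mu (n : ℕ) : Fin 4 → (Fin n → ℚ) :=
  ![0, toRat (fundWt n 1), (-1 / 2 : ℚ) • toRat (fundWt n n),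
    (-3 / 2 : ℚ) • toRat (fundWt n n) + toRat (fundWt n (n - 1))]

section Field

variable {K : Type*} [Field K]

/-- `q ^ x` for `x ∈ ¼ ℤ`, where `p = q ^ (1/4)`. -/
def qpow (p : K) (x : ℚ) : K := p ^ ⌊4 * x⌋

/-- `[x] = (q ^ x - q ^ (-x)) / (q - q⁻¹)`. -/
def qnum (p : K) (x : ℚ) : K := (qpow p x - qpow p (-x)) / (qpow p 1 - qpow p (-1))

end Field

/-! ### The Fock space -/

/-- Variables of the Fock space: `inl (i, k)` is `a_{i+1}(-k)`, `inr (i, k)` is `b_{i+1}(-k)`. -/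
abbrev Var (n : ℕ) := (Fin n × ℕ+) ⊕ (Fin n × ℕ+)

/-- One sector `F_{α, β}`: polynomials in the creation operators applied to `|α, β⟩`. -/
abbrev Sector (n : ℕ) (K : Type*) [Field K] := MvPolynomial (Var n) K

/-- The Fock space, the direct sum of the sectors `F_{α, β}` over all `(α, β)`;
the vacuum vector `|α, β⟩` is `Finsupp.single (α, β) 1`. -/
abbrev Fock (n : ℕ) (K : Type*) [Field K] := Charge n →₀ Sector n K

section Modes

variable {n : ℕ} {K : Type*} [Field K]

/-- The action of `a_{i+1}(-k)`, `k > 0`, on a sector. -/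
def aNeg (i : Fin n) (k : ℕ+) : Module.End K (Sector n K) :=
  LinearMap.mulLeft K (MvPolynomial.X (Sum.inl (i, k)))

/-- The action of `b_{i+1}(-k)`, `k > 0`, on a sector. -/
def bNeg (i : Fin n) (k : ℕ+) : Module.End K (Sector n K) :=
  LinearMap.mulLeft K (MvPolynomial.X (Sum.inr (i, k)))

/-- The action of `a_{i+1}(k)`, `k > 0`, on a sector: it kills the vacuum vector and
`[a_i(k), a_j(-l)] = δ_{kl} [k (α_i | α_j)] [-k/2] / k`. -/
def aPos (p : K) (i : Fin n) (k : ℕ+) : Module.End K (Sector n K) :=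
  ∑ j : Fin n,
    (qnum p ((k : ℕ) * form (toRat (root n ((i : ℕ) + 1))) (toRat (root n ((j : ℕ) + 1)))) *
        qnum p (-((k : ℕ) : ℚ) / 2) / ((k : ℕ) : K)) •
      (MvPolynomial.pderiv (Sum.inl (j, k)) : Derivation K (Sector n K) (Sector n K)).toLinearMap

/-- The action of `b_{i+1}(k)`, `k > 0`, on a sector: it kills the vacuum vector and
`[b_i(k), b_j(-l)] = k δ_{ij} δ_{kl}`. -/
def bPos (i : Fin n) (k : ℕ+) : Module.End K (Sector n K) :=
  ((k : ℕ) : K) •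
    (MvPolynomial.pderiv (Sum.inr (i, k)) : Derivation K (Sector n K) (Sector n K)).toLinearMap

end Modes

/-! ### Normally ordered exponentials -/

/-- The coefficient of `z ^ N` in `exp (∑_{k ≥ 1} A k z ^ k)`. -/
def expCoeff {K R : Type*} [Field K] [Ring R] [Algebra K R] (A : ℕ+ → R) (N : ℕ) : R :=
  ∑ j ∈ Finset.range (N + 1), ((j.factorial : K)⁻¹) •
    PowerSeries.coeff N ((PowerSeries.mk fun m => if h : 0 < m then A (m.toPNat h) else 0) ^ j)

/-- The data of a normally ordered exponential operator
`exp (∑_{k ≥ 1} ∑_i (creA k i a_i(-k) + creB k i b_i(-k)) z ^ k)`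
`exp (∑_{k ≥ 1} ∑_i (annA k i a_i(k) + annB k i b_i(k)) z ^ (-k))`
`e ^ (shA, shB) · Z`, where the zero-mode factor `Z` multiplies the sector with label `w` by
`scal w · z ^ (pow w)`, and `e ^ (shA, shB)` maps `|α, β⟩` to `|α + shA, β + shB⟩`. -/
@[ext]
structure NExp (n : ℕ) (K : Type*) where
  creA : ℕ+ → Fin n → K
  creB : ℕ+ → Fin n → K
  annA : ℕ+ → Fin n → K
  annB : ℕ+ → Fin n → K
  shA : Fin n → ℤ
  shB : Fin n → ℤ
  scal : Charge n → K
  pow : Charge n → ℚ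

/-- A formal series `A(z) = ∑_r A_r z ^ r` of operators on the Fock space;
`A r` is the coefficient of `z ^ r`. -/
abbrev Series (n : ℕ) (K : Type*) [Field K] := ℚ → Module.End K (Fock n K)

namespace NExp

variable {n : ℕ} {K : Type*} [Field K]

/-- The normally ordered product of two exponentials in the same variable: creation operators and
`e ^ γ` to the left, annihilation operators and `z ^ (zero mode)` to the right.  It is the ordinary
product whenever the modes occurring in the two factors commute. -/
instance : Mul (NExp n K) where
  mul V W :=
    { creA := V.creA + W.creA, creB := V.creB + W.creB
      annA := V.annA + W.annA, annB := V.annB + W.annB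
      shA := V.shA + W.shA, shB := V.shB + W.shB
      scal := V.scal * W.scal, pow := V.pow + W.pow }

/-- `∑_i (creA k i a_i(-k) + creB k i b_i(-k))`. -/
def creMode (V : NExp n K) (k : ℕ+) : Module.End K (Sector n K) :=
  ∑ i, (V.creA k i • aNeg i k + V.creB k i • bNeg i k)

/-- `∑_i (annA k i a_i(k) + annB k i b_i(k))`. -/
def annMode (p : K) (V : NExp n K) (k : ℕ+) : Module.End K (Sector n K) :=
  ∑ i, (V.annA k i • aPos p i k + V.annB k i • bPos i k)

end NExp

/-! The annihilation exponential is locally finite: on a given vector only finitely many of its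
coefficients are nonzero. -/

section LocallyFinite

variable {n : ℕ} {K : Type*} [Field K]

/-- The degree of a monomial, where `a_i(-k)` and `b_i(-k)` have degree `k`. -/
def degOf : (Var n →₀ ℕ) →+ ℕ :=
  Finsupp.weight (Sum.elim (fun x => (x.2 : ℕ)) (fun x => (x.2 : ℕ)))

/-- The span of the monomials of degree at most `M`. -/
def degLE (n : ℕ) (K : Type*) [Field K] (M : ℤ) : Submodule K (Sector n K) :=
  Submodule.span K {f | ∃ s : Var n →₀ ℕ, (degOf s : ℤ) ≤ M ∧ f = MvPolynomial.monomial s 1}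

/-- The operator `T` lowers the degree by at least `d`. -/
def Lowers (d : ℕ) (T : Module.End K (Sector n K)) : Prop :=
  ∀ M : ℤ, ∀ f ∈ degLE n K M, T f ∈ degLE n K (M - d)

theorem Lowers.zero (d : ℕ) : Lowers d (0 : Module.End K (Sector n K)) :=
  fun _ _ _ => Submodule.zero_mem _

theorem Lowers.one : Lowers 0 (1 : Module.End K (Sector n K)) := by
  intro M f hf
  simpa using hf

theorem Lowers.add {d : ℕ} {S T : Module.End K (Sector n K)} (hS : Lowers d S) (hT : Lowers d T) :
    Lowers d (S + T) :=
  fun M f hf => Submodule.add_mem _ (hS M f hf) (hT M f hf)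

theorem Lowers.smul {d : ℕ} (c : K) {T : Module.End K (Sector n K)} (hT : Lowers d T) :
    Lowers d (c • T) :=
  fun M f hf => Submodule.smul_mem _ c (hT M f hf)

theorem Lowers.sum {d : ℕ} {ι : Type*} (s : Finset ι) {T : ι → Module.End K (Sector n K)}
    (hT : ∀ i ∈ s, Lowers d (T i)) : Lowers d (∑ i ∈ s, T i) := by
  intro M f hf
  rw [LinearMap.sum_apply]
  exact Submodule.sum_mem _ fun i hi => hT i hi M f hf

theorem Lowers.mul {d e : ℕ} {S T : Module.End K (Sector n K)} (hS : Lowers d S)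
    (hT : Lowers e T) : Lowers (d + e) (S * T) := by
  intro M f hf
  have h := hS _ _ (hT M f hf)
  have hM : M - (e : ℤ) - (d : ℤ) = M - ((d + e : ℕ) : ℤ) := by push_cast; ring
  rw [hM] at h
  exact h

theorem lowers_pderiv (v : Var n) (d : ℕ)
    (hd : degOf (Finsupp.single v 1) = d) :
    Lowers d (MvPolynomial.pderiv v : Derivation K (Sector n K) (Sector n K)).toLinearMap := by
  intro M f hf
  induction hf using Submodule.span_induction with
  | zero => rw [map_zero]; exact Submodule.zero_mem _
  | add x y _ _ hx hy => rw [map_add]; exact Submodule.add_mem _ hx hy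
  | smul a x _ hx => rw [map_smul]; exact Submodule.smul_mem _ a hx
  | mem x hx =>
    obtain ⟨s, hs, rfl⟩ := hx
    change MvPolynomial.pderiv v (MvPolynomial.monomial s 1) ∈ _
    rw [MvPolynomial.pderiv_monomial]
    by_cases h0 : s v = 0
    · simp [h0]
    · have hs' : s = (s - Finsupp.single v 1) + Finsupp.single v 1 := by
        ext u
        by_cases hu : v = u
        · subst hu; simp; omega
        · simp [hu]
      have hdeg : degOf s = degOf (s - Finsupp.single v 1) + d := by
        conv_lhs => rw [hs']
        rw [map_add, hd]
      have : MvPolynomial.monomial (s - Finsupp.single v 1) ((1 : K) * (s v : K)) =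
          (s v : K) • MvPolynomial.monomial (s - Finsupp.single v 1) (1 : K) := by
        rw [MvPolynomial.smul_monomial]; simp
      rw [this]
      refine Submodule.smul_mem _ _ (Submodule.subset_span ⟨_, ?_, rfl⟩)
      omega

theorem lowers_annMode (p : K) (V : NExp n K) (k : ℕ+) : Lowers (k : ℕ) (V.annMode p k) := by
  refine Lowers.sum _ fun i _ => Lowers.add (Lowers.smul _ ?_) (Lowers.smul _ ?_)
  · refine Lowers.sum _ fun j _ => Lowers.smul _ (lowers_pderiv _ _ ?_)
    simp [degOf, Finsupp.weight_single]
  · refine Lowers.smul _ (lowers_pderiv _ _ ?_)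
    simp [degOf, Finsupp.weight_single]

theorem lowers_expCoeff (A : ℕ+ → Module.End K (Sector n K)) (hA : ∀ k : ℕ+, Lowers (k : ℕ) (A k))
    (N : ℕ) : Lowers N (expCoeff (K := K) A N) := by
  refine Lowers.sum _ fun j hj => Lowers.smul _ ?_
  clear hj
  induction j generalizing N with
  | zero =>
    rw [pow_zero, PowerSeries.coeff_one]
    split_ifs with h
    · subst h; exact Lowers.one
    · exact Lowers.zero _
  | succ j ih =>
    rw [pow_succ, PowerSeries.coeff_mul]
    refine Lowers.sum _ fun x hx => ?_
    rw [← Finset.HasAntidiagonal.mem_antidiagonal.mp hx]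
    refine Lowers.mul (ih _) ?_
    rw [PowerSeries.coeff_mk]
    split_ifs with h
    · exact hA (x.2.toPNat h)
    · exact Lowers.zero _

theorem exists_mem_degLE (f : Sector n K) : ∃ M : ℕ, f ∈ degLE n K M := by
  refine ⟨∑ s ∈ f.support, degOf s, ?_⟩
  rw [MvPolynomial.as_sum f]
  refine Submodule.sum_mem _ fun s hs => ?_
  have : MvPolynomial.monomial s (f.coeff s) = f.coeff s • MvPolynomial.monomial s (1 : K) := by
    rw [MvPolynomial.smul_monomial]; simp
  rw [this]
  refine Submodule.smul_mem _ _ (Submodule.subset_span ⟨s, ?_, rfl⟩)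
  rw [← MvPolynomial.as_sum f]
  exact_mod_cast Finset.single_le_sum (f := fun s => degOf s) (fun _ _ => Nat.zero_le _) hs

theorem annExp_eventually_zero (p : K) (V : NExp n K) (f : Sector n K) :
    ∃ M : ℕ, ∀ k, M < k → expCoeff (K := K) (V.annMode p) k f = 0 := by
  obtain ⟨M, hM⟩ := exists_mem_degLE f
  refine ⟨M, fun k hk => ?_⟩
  have h := lowers_expCoeff _ (lowers_annMode p V) k _ _ hM
  have hbot : degLE n K ((M : ℤ) - (k : ℤ)) = ⊥ := by
    rw [degLE, Submodule.span_eq_bot]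
    rintro _ ⟨s, hs, -⟩
    omega
  rw [hbot] at h
  simpa using h

end LocallyFinite

namespace NExp

variable {n : ℕ} {K : Type*} [Field K]

/-- The term of index `(j, k)` in the coefficient of `z ^ d` in the product of the creation
exponential and the annihilation exponential: it is present if `j - k = d`. -/
def oscTerm (p : K) (V : NExp n K) (d : ℚ) (x : ℕ × ℕ) : Module.End K (Sector n K) :=
  if (x.1 : ℚ) - (x.2 : ℚ) = d then
    expCoeff (K := K) V.creMode x.1 * expCoeff (K := K) (V.annMode p) x.2
  else 0

theorem oscTerm_finite (p : K) (V : NExp n K) (d : ℚ) (f : Sector n K) :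
    (Function.support fun x => V.oscTerm p d x f).Finite := by
  obtain ⟨M, hM⟩ := annExp_eventually_zero p V f
  refine Set.Finite.of_finite_image (f := Prod.snd) ((Set.finite_Iic M).subset ?_) ?_
  · rintro _ ⟨x, hx, rfl⟩
    by_contra hlt
    refine hx ?_
    have : expCoeff (K := K) (V.annMode p) x.2 f = 0 := hM _ (by simpa using hlt)
    simp only [oscTerm]
    split_ifs
    · rw [Module.End.mul_apply, this, map_zero]
    · rfl
  · have key : ∀ x, x ∈ Function.support (fun x => V.oscTerm p d x f) →
        (x.1 : ℚ) - (x.2 : ℚ) = d := by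
      intro x hx
      by_contra hne
      exact hx (by simp [oscTerm, hne])
    intro x hx y hy hxy
    have h1 := key x hx
    have h2 := key y hy
    have h3 : (x.1 : ℚ) = y.1 := by
      have : (x.2 : ℚ) = y.2 := by exact_mod_cast hxy
      linarith
    exact Prod.ext (by exact_mod_cast h3) hxy

/-- The coefficient of `z ^ d` in the product of the two oscillator exponentials, on a sector
(a finite sum on every vector). -/
def osc (p : K) (V : NExp n K) (d : ℚ) : Module.End K (Sector n K) where
  toFun f := ∑ᶠ x : ℕ × ℕ, V.oscTerm p d x f
  map_add' f g := by
    simp only [map_add]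
    exact finsum_add_distrib (V.oscTerm_finite p d f) (V.oscTerm_finite p d g)
  map_smul' c f := by
    simp only [map_smul, RingHom.id_apply]
    exact (smul_finsum' c (V.oscTerm_finite p d f)).symm

/-- The operator series of a normally ordered exponential. -/
def series (p : K) (V : NExp n K) : Series n K := fun r =>
  Finsupp.lsum K fun w : Charge n =>
    (Finsupp.lsingle (w.1, w.2.1 + V.shA, w.2.2 + V.shB) : Sector n K →ₗ[K] Fock n K) ∘ₗ
      (V.scal w • V.osc p (r - V.pow w))

end NExp

/-- The `q`-difference operator `∂ f(z) = (f(q^{1/2} z) - f(q^{-1/2} z)) / ((q^{1/2} - q^{-1/2}) z)`: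
if `G y` is the series `f(q ^ y z)`, then `qdiff p G y` is the series `(∂ f)(q ^ y z)`. -/
def qdiff {n : ℕ} {K : Type*} [Field K] (p : K) (G : ℚ → Series n K) : ℚ → Series n K :=
  fun y r => ((qpow p (1 / 2) - qpow p (-1 / 2)) * qpow p y)⁻¹ •
    (G (y + 1 / 2) (r + 1) - G (y - 1 / 2) (r + 1))

/-! ### The currents and the vertex operator -/

section Currents

variable {K : Type*} [Field K]

/-- `Y_i^±(z)`, with the sign `s = ±1`. -/
def Y (p : K) (n i : ℕ) (s : ℤ) : NExp n K where
  creA k j := if (j : ℕ) + 1 = i then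
    s * (qpow p ((s : ℚ) * (k : ℕ) / 4) / qnum p (-((k : ℕ) : ℚ) / 2)) else 0
  creB _ _ := 0
  annA k j := if (j : ℕ) + 1 = i then
    -s * (qpow p ((s : ℚ) * (k : ℕ) / 4) / qnum p (-((k : ℕ) : ℚ) / 2)) else 0
  annB _ _ := 0
  shA := s • root n i
  shB := 0
  scal _ := 1
  pow w := -s * (2 * form (toRat (root n i)) w.al)

/-- `Z_i^±(q ^ y z)`, with the sign `s = ±1`. -/
def Z (p : K) (n i : ℕ) (s : ℤ) (y : ℚ) : NExp n K where
  creA _ _ := 0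
  creB k j := if (j : ℕ) + 1 = i then s * (qpow p (y * (k : ℕ)) / ((k : ℕ) : K)) else 0
  annA _ _ := 0
  annB k j := if (j : ℕ) + 1 = i then -s * (qpow p (-(y * (k : ℕ))) / ((k : ℕ) : K)) else 0
  shA := 0
  shB := s • eps n i
  scal w := qpow p (y * (s * (2 * form (toRat (eps n i)) w.be)))
  pow w := s * (2 * form (toRat (eps n i)) w.be)

/-- `X_i^+(z)`: it is `∂Z_i^+(z) Z_{i+1}^-(z) Y_i^+(z)` for `i < n`, and
`((q^{1/2} + q^{-1/2})⁻¹ :Z_n^+(z) ∂²Z_n^+(z): - :∂Z_n^+(q^{1/2} z) ∂Z_n^+(q^{-1/2} z):) Y_n^+(z)`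
for `i = n`. -/
def Xplus (p : K) (n i : ℕ) : Series n K :=
  if i < n then
    qdiff p (fun y => (Z p n i 1 y * Z p n (i + 1) (-1) 0 * Y p n i 1).series p) 0
  else
    (qpow p (1 / 2) + qpow p (-1 / 2))⁻¹ •
        qdiff p (qdiff p fun y => (Z p n n 1 0 * Z p n n 1 y * Y p n n 1).series p) 0
      - qdiff p (fun x => qdiff p
          (fun y => (Z p n n 1 x * Z p n n 1 y * Y p n n 1).series p) (-1 / 2)) (1 / 2)

/-- `X_i^-(z)`: it is `Z_i^-(z) ∂Z_{i+1}^+(z) Y_i^-(z)` for `i < n`, and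
`(q^{1/2} + q^{-1/2})⁻¹ :Z_n^-(q^{1/2} z) Z_n^-(q^{-1/2} z): Y_n^-(z)` for `i = n`. -/
def Xminus (p : K) (n i : ℕ) : Series n K :=
  if i < n then
    qdiff p (fun y => (Z p n i (-1) 0 * Z p n (i + 1) 1 y * Y p n i (-1)).series p) 0
  else
    (qpow p (1 / 2) + qpow p (-1 / 2))⁻¹ •
      (Z p n n (-1) (1 / 2) * Z p n n (-1) (-1 / 2) * Y p n n (-1)).series p

/-- The mode `x(m)` of a current `X(z) = ∑_m x(m) z ^ (-m-1)`. -/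
def mode {n : ℕ} (X : Series n K) (m : ℤ) : Module.End K (Fock n K) := X (-(m : ℚ) - 1)

/-- The coefficient of `a_{j+1}(m)` in the element `a_{\bar 1}(m)` of the Heisenberg algebra,
which satisfies `[a_i(m), a_{\bar 1}(l)] = δ_{i1} δ_{m,-l}` (for `n ≥ 2`). -/
def abarCoeff (p : K) (n : ℕ) (m : ℤ) (j : Fin n) : K :=
  (m : K) / qnum p ((m : ℚ) / 2) ^ 2 *
    (if (j : ℕ) + 1 < n then qnum p (((n : ℚ) - (j : ℕ)) * m) / qnum p (((n : ℚ) - (j : ℕ)) * m / 2) else 1) *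
    (qnum p (((n : ℚ) + 1) * m / 2) / qnum p (((n : ℚ) + 1) * m))

/-- The factor of `Φ_{\bar 1}(z)` that involves the Heisenberg algebra of the `a_i`:
`exp (∑_{k ≥ 1} ([k/2]/k) q^{(n+1/4)k} a_{\bar 1}(-k) z^k)`
`exp (∑_{k ≥ 1} ([k/2]/k) q^{-(n+3/4)k} a_{\bar 1}(k) z^{-k})`
`e^{λ_1} (q^{n+1/2} z)^{-λ_1(0) + 1 - λ_1(μ)}`, where `λ_1(0)` acts on `|α, β⟩` as
`λ_1(α) = 2 (λ_1 | α)`, and `λ_1(μ) = 2 (λ_1 | μ)`. -/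
def phiA (p : K) (n : ℕ) (μ : Fin n → ℚ) : NExp n K where
  creA k j := qnum p (((k : ℕ) : ℚ) / 2) / ((k : ℕ) : K) * qpow p (((n : ℚ) + 1 / 4) * (k : ℕ)) *
    abarCoeff p n (-(k : ℕ)) j
  creB _ _ := 0
  annA k j := qnum p (((k : ℕ) : ℚ) / 2) / ((k : ℕ) : K) * qpow p (-(((n : ℚ) + 3 / 4) * (k : ℕ))) *
    abarCoeff p n (k : ℕ) j
  annB _ _ := 0
  shA := fundWt n 1
  shB := 0
  scal w := qpow p (((n : ℚ) + 1 / 2) *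
    (-(2 * form (toRat (fundWt n 1)) w.al) + 1 - 2 * form (toRat (fundWt n 1)) μ))
  pow w := -(2 * form (toRat (fundWt n 1)) w.al) + 1 - 2 * form (toRat (fundWt n 1)) μ

/-- The component `Φ_{\bar 1}(z)` of the type I vertex operator on the module of highest weight
`μ_{ι+1}`, as an operator on the whole Fock space; `c` is its normalization constant. -/
def PhiBar1 (p : K) (n : ℕ) (ι : Fin 4) (c : K) : Series n K :=
  c • qdiff p (fun y => (phiA p n (mu n ι) * Z p n 1 1 ((n : ℚ) + 1 / 2 + y)).series p) 0

/-- The `v`-commutator `[A(z), B(w)]_v = A(z) B(w) - v B(w) A(z)`; the value at `(r, s)` is the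
coefficient of `z ^ r w ^ s`. -/
def qcomm {n : ℕ} (v : K) (A B : Series n K) : ℚ → ℚ → Module.End K (Fock n K) :=
  fun r s => A r * B s - v • (B s * A r)

/-- Multiplication of a series in `z`, `w` by `z / w`. -/
def mulZdivW {n : ℕ} (G : ℚ → ℚ → Module.End K (Fock n K)) :
    ℚ → ℚ → Module.End K (Fock n K) :=
  fun r s => G (r - 1) (s + 1)

end Currents

end

end SpVertex

/-! Expanding every `∂` writes the currents and `Φ` as finite linear combinations of normally
ordered exponentials. For two of these, `V(z)W(w)` is the normally ordered product `:V(z)W(w):`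
times a scalar series in `w/z`, the exponential of the mode commutators, times a zero-mode constant
and a power of `z`; `W(w)V(z)` is the same normally ordered product times a series in `z/w`. In
every pair used here the powers cancel, so a `v`-commutator is governed by one bilateral scalar
series, `commFactor`, and each relation becomes an identity between scalar series.

The `a`-part of `Φ` has contractions only with `Y_1`, because `a_{\bar 1}` is dual to `a_1`
(`sum_abarCoeff_mul_aPair`), and its `b`-part only with `Z_1`. Hence `Φ` commutes with every
`X_i^±`, `i ≥ 2`.

Put `u = q^{n+1/2}`, and label by `y` and `x` the terms coming from the `∂` in `Φ` and in `X_1^±`.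
For `X_1^+` both orders give expansions, in opposite regions, of `(q^y - q^x w/(uz)) / (1 -
w/(uz))`. The commutator is therefore `q^y - q^x` times the delta function at `w = uz`
(`commFactor_plusTerm`). Terms with `x = y` vanish; the terms `(y, x)` and `(x, y)` carry opposite
coefficients and the same normally ordered product at `w = uz` (`phiZ_mul_dilate_plusTerm`), so they
cancel.

For `X_1^-` one of the two orders has a constant contraction factor, for each of `y = ±1/2`. The
`q^{-1/2}`- and `q^{1/2}`-commutators then have factors with the same single pole, expanded in the
same region, and their ratio is `q^n z/w` (`commFactor_minusTerm`). This relation holds term by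
term. -/

namespace SpVertex

noncomputable section

/-! ### Exponentials of mode series, characterized by the Euler operator. -/

section ExpCoeff

open PowerSeries

variable {K R : Type*} [Field K] [Ring R] [Algebra K R]

/-- The power series `∑_{k ≥ 1} A k t ^ k`. -/
def modeSeries (A : ℕ+ → R) : PowerSeries R :=
  PowerSeries.mk fun m => if h : 0 < m then A (m.toPNat h) else 0

theorem coeff_modeSeries_zero (A : ℕ+ → R) : coeff 0 (modeSeries A) = 0 := by
  simp [modeSeries]

theorem coeff_modeSeries_pnat (A : ℕ+ → R) (k : ℕ+) : coeff (k : ℕ) (modeSeries A) = A k := by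
  have : (k : ℕ).toPNat k.pos = k := rfl
  simp [modeSeries, k.pos, this]

/-- Without a constant term, the `j`-th power starts in degree `j`. This makes the truncation in
`expCoeff` harmless and lets it be moved freely in `expCoeff_eq_sum`. -/
theorem coeff_modeSeries_pow_of_lt (A : ℕ+ → R) {j N : ℕ} (h : N < j) :
    coeff N (modeSeries A ^ j) = 0 := by
  induction j generalizing N with
  | zero => omega
  | succ j ih =>
    rw [pow_succ, coeff_mul]
    refine Finset.sum_eq_zero fun x hx => ?_
    have hx' := Finset.HasAntidiagonal.mem_antidiagonal.mp hx
    rcases Nat.eq_zero_or_pos x.2 with h0 | h0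
    · rw [h0, coeff_modeSeries_zero, mul_zero]
    · rw [ih (by omega), zero_mul]

theorem expCoeff_eq_sum (A : ℕ+ → R) {N B : ℕ} (h : N < B) :
    expCoeff (K := K) A N =
      ∑ j ∈ Finset.range B, ((j.factorial : K)⁻¹) • coeff N (modeSeries A ^ j) := by
  refine Finset.sum_subset (by simpa using h) fun j _ hj => ?_
  have hj' : N < j := by simpa using hj
  exact (congrArg _ (coeff_modeSeries_pow_of_lt A hj')).trans (smul_zero _)

theorem expCoeff_zero (A : ℕ+ → R) : expCoeff (K := K) A 0 = 1 := by
  simp [expCoeff_eq_sum A zero_lt_one]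

/-- The exponential `exp (∑_{k ≥ 1} A k t ^ k)`. -/
def expSeries (K : Type*) {R : Type*} [Field K] [Ring R] [Algebra K R] (A : ℕ+ → R) :
    PowerSeries R :=
  PowerSeries.mk (expCoeff (K := K) A)

theorem coeff_expSeries (A : ℕ+ → R) (N : ℕ) :
    coeff N (expSeries K A) = expCoeff (K := K) A N := by
  simp [expSeries]

/-- The Euler operator `t d/dt`. -/
def euler (f : PowerSeries R) : PowerSeries R := PowerSeries.mk fun N => (N : R) * coeff N f

theorem coeff_euler (f : PowerSeries R) (N : ℕ) : coeff N (euler f) = (N : R) * coeff N f := by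
  simp [euler]

theorem euler_add (f g : PowerSeries R) : euler (f + g) = euler f + euler g := by
  ext N; simp [coeff_euler, mul_add]

theorem euler_sub (f g : PowerSeries R) : euler (f - g) = euler f - euler g := by
  ext N; simp [coeff_euler, mul_sub]

theorem euler_mul (f g : PowerSeries R) : euler (f * g) = euler f * g + f * euler g := by
  ext N
  simp only [coeff_euler, map_add, coeff_mul, Finset.mul_sum, ← Finset.sum_add_distrib]
  refine Finset.sum_congr rfl fun x hx => ?_
  rw [← Finset.HasAntidiagonal.mem_antidiagonal.mp hx, Nat.cast_add, add_mul,
    ← mul_assoc, ← mul_assoc, ← mul_assoc,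
    (Nat.cast_commute x.2 (coeff x.1 f)).eq]

theorem euler_C (r : R) : euler (C r) = 0 := by
  ext N
  rw [coeff_euler, coeff_C]
  split_ifs with h <;> simp [h]

/-- Since `b` has no constant term, `N · f_N` involves only coefficients of `f` below `N`, so the
equation `t f' = b f` determines `f` from its constant term. This uniqueness is the tool for the
exponential identities `expSeries_add`, `C_mul_expSeries` and `expCoeff_log_ratio`, where composing
formal logarithms in a noncommutative ring is avoided. -/
theorem eq_zero_of_euler_eq_mul [CharZero K] {b f : PowerSeries R} (hb : coeff 0 b = 0)
    (hf : coeff 0 f = 0) (h : euler f = b * f) : f = 0 := by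
  ext N
  induction N using Nat.strong_induction_on with
  | _ N ih =>
    rcases Nat.eq_zero_or_pos N with rfl | hN
    · simpa using hf
    have h1 : (N : R) * coeff N f = 0 := by
      rw [← coeff_euler, h, coeff_mul]
      refine Finset.sum_eq_zero fun x hx => ?_
      have hx' := Finset.HasAntidiagonal.mem_antidiagonal.mp hx
      rcases Nat.eq_zero_or_pos x.1 with h0 | h0
      · rw [h0, hb, zero_mul]
      · rw [ih _ (by omega)]; simp
    have h2 : (N : K) • coeff N f = 0 := by
      rw [Algebra.smul_def, map_natCast, h1]
    have h3 : (N : K) ≠ 0 := by exact_mod_cast hN.ne'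
    simpa [h3] using h2

theorem eq_of_euler_eq_mul [CharZero K] {b f g : PowerSeries R} (hb : coeff 0 b = 0)
    (hfg : coeff 0 f = coeff 0 g) (hf : euler f = b * f) (hg : euler g = b * g) : f = g :=
  sub_eq_zero.mp <| eq_zero_of_euler_eq_mul (K := K) hb (by rw [map_sub, hfg, sub_self])
    (by rw [euler_sub, hf, hg, mul_sub])

theorem euler_pow {f : PowerSeries R} (hf : Commute f (euler f)) (j : ℕ) :
    euler (f ^ (j + 1)) = ((j + 1 : ℕ) : PowerSeries R) * (euler f * f ^ j) := by
  induction j with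
  | zero => simp
  | succ j ih =>
    rw [pow_succ, euler_mul, ih, (hf.pow_left (j + 1)).eq, Nat.cast_succ (j + 1), add_mul, one_mul,
      pow_succ]
    simp only [mul_assoc]

theorem coeff_zero_euler (f : PowerSeries R) : coeff 0 (euler f) = 0 := by
  simp [coeff_euler]

theorem modeSeries_commute {A B : ℕ+ → R} (h : ∀ k l, Commute (A k) (B l)) (m l : ℕ) :
    Commute (coeff m (modeSeries A)) (coeff l (modeSeries B)) := by
  simp only [modeSeries, coeff_mk]
  split_ifs
  · exact h _ _
  · exact Commute.zero_right _
  · exact Commute.zero_left _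
  · exact Commute.zero_left _

theorem commute_of_coeff {f g : PowerSeries R} (h : ∀ m l, Commute (coeff m f) (coeff l g)) :
    Commute f g := by
  ext N
  rw [coeff_mul, coeff_mul, ← Finset.Nat.sum_antidiagonal_swap]
  exact Finset.sum_congr rfl fun x _ => (h _ _).eq

/-- Commutativity of the modes gives the chain rule for powers, and the factor `j + 1` it produces
turns `1/(j+1)!` into `1/j!`. -/
theorem euler_expSeries [CharZero K] {A : ℕ+ → R} (hA : ∀ k l, Commute (A k) (A l)) :
    euler (expSeries K A) = euler (modeSeries A) * expSeries K A := by
  have hc : Commute (modeSeries A) (euler (modeSeries A)) := by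
    refine commute_of_coeff fun m l => ?_
    rw [coeff_euler]
    exact (Nat.cast_commute l _).symm.mul_right (modeSeries_commute hA m l)
  ext N
  rw [coeff_euler, coeff_expSeries, expCoeff_eq_sum A (show N < N + 1 by omega),
    Finset.sum_range_succ', mul_add]
  have h0 : (N : R) * (((Nat.factorial 0 : ℕ) : K)⁻¹ • coeff N (modeSeries A ^ 0)) = 0 := by
    rw [pow_zero, coeff_one]
    split_ifs with h <;> simp [h]
  rw [h0, add_zero, Finset.mul_sum]
  have h1 : ∀ j ∈ Finset.range N, (N : R) * (((Nat.factorial (j + 1) : ℕ) : K)⁻¹ •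
      coeff N (modeSeries A ^ (j + 1))) =
      ∑ x ∈ Finset.HasAntidiagonal.antidiagonal N, coeff x.1 (euler (modeSeries A)) *
        (((Nat.factorial j : ℕ) : K)⁻¹ • coeff x.2 (modeSeries A ^ j)) := by
    intro j _
    rw [mul_smul_comm, ← coeff_euler, euler_pow hc]
    have : coeff N (((j + 1 : ℕ) : PowerSeries R) * (euler (modeSeries A) * modeSeries A ^ j)) =
        ((j + 1 : ℕ) : K) • coeff N (euler (modeSeries A) * modeSeries A ^ j) := by
      rw [← nsmul_eq_mul, map_nsmul, ← Nat.cast_smul_eq_nsmul K]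
    rw [this, smul_smul, coeff_mul, Finset.smul_sum]
    refine Finset.sum_congr rfl fun x _ => ?_
    rw [mul_smul_comm]
    congr 1
    rw [Nat.factorial_succ, Nat.cast_mul, mul_inv_rev, mul_assoc, inv_mul_cancel₀, mul_one]
    exact_mod_cast Nat.succ_ne_zero j
  rw [Finset.sum_congr rfl h1, Finset.sum_comm, coeff_mul]
  refine Finset.sum_congr rfl fun x hx => ?_
  have hx' := Finset.HasAntidiagonal.mem_antidiagonal.mp hx
  rw [← Finset.mul_sum]
  -- The factor `euler (modeSeries A)` vanishes in degree `0`, so the remaining degree is below `N`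
  -- and `N` terms of the exponential suffice.
  rcases Nat.eq_zero_or_pos x.1 with h | h
  · rw [h, coeff_zero_euler, zero_mul, zero_mul]
  · rw [coeff_expSeries, expCoeff_eq_sum A (show x.2 < N by omega)]

/-- Conjugation passes through an exponential coefficient by coefficient; stated with `SemiconjBy`
so that `y` need not be invertible. -/
theorem semiconjBy_expCoeff {A B : ℕ+ → R} {y : R} (h : ∀ k, SemiconjBy y (A k) (B k)) (N : ℕ) :
    SemiconjBy y (expCoeff (K := K) A N) (expCoeff (K := K) B N) := by
  have key : ∀ j N, SemiconjBy y (coeff N (modeSeries A ^ j)) (coeff N (modeSeries B ^ j)) := by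
    intro j
    induction j with
    | zero =>
      intro N
      simp only [pow_zero, coeff_one]
      split_ifs
      · exact SemiconjBy.one_right y
      · exact SemiconjBy.zero_right y
    | succ j ih =>
      intro N
      simp only [pow_succ, coeff_mul, SemiconjBy, Finset.mul_sum, Finset.sum_mul]
      refine Finset.sum_congr rfl fun x _ => ((ih x.1).mul_right ?_).eq
      simp only [modeSeries, coeff_mk]
      split_ifs
      · exact h _
      · exact SemiconjBy.zero_right y
  rw [expCoeff_eq_sum A (Nat.lt_succ_self N), expCoeff_eq_sum B (Nat.lt_succ_self N)]
  simp only [SemiconjBy, Finset.mul_sum, Finset.sum_mul, mul_smul_comm, smul_mul_assoc]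
  exact Finset.sum_congr rfl fun j _ => congrArg _ (key j N).eq

theorem commute_expCoeff {A : ℕ+ → R} {y : R} (h : ∀ k, Commute y (A k)) (N : ℕ) :
    Commute y (expCoeff (K := K) A N) :=
  semiconjBy_expCoeff h N

theorem expCoeff_commute {A B : ℕ+ → R} (h : ∀ k l, Commute (A k) (B l)) (M N : ℕ) :
    Commute (expCoeff (K := K) A M) (expCoeff (K := K) B N) :=
  commute_expCoeff (fun l => (commute_expCoeff (fun k => (h k l).symm) M).symm) N

theorem map_expCoeff {R' : Type*} [Ring R'] [Algebra K R'] (φ : R →ₐ[K] R') (A : ℕ+ → R) (N : ℕ) :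
    expCoeff (K := K) (fun k => φ (A k)) N = φ (expCoeff (K := K) A N) := by
  have h : modeSeries (fun k => φ (A k)) = PowerSeries.map (φ : R →+* R') (modeSeries A) := by
    ext m
    simp only [modeSeries, coeff_mk, coeff_map]
    split_ifs <;> simp
  rw [expCoeff_eq_sum _ (Nat.lt_succ_self N), expCoeff_eq_sum A (Nat.lt_succ_self N), map_sum]
  refine Finset.sum_congr rfl fun j _ => ?_
  rw [h, ← map_pow, coeff_map, map_smul]
  rfl

theorem expSeries_add [CharZero K] {A B : ℕ+ → R} (hA : ∀ k l, Commute (A k) (A l))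
    (hB : ∀ k l, Commute (B k) (B l)) (hAB : ∀ k l, Commute (A k) (B l)) :
    expSeries K (fun k => A k + B k) = expSeries K A * expSeries K B := by
  have hm : modeSeries (fun k => A k + B k) = modeSeries A + modeSeries B := by
    ext m
    simp only [modeSeries, coeff_mk, map_add]
    split_ifs <;> simp
  refine eq_of_euler_eq_mul (K := K) (coeff_zero_euler (modeSeries fun k => A k + B k)) ?_
    (euler_expSeries ?_) ?_
  · simp [coeff_expSeries, coeff_mul, expCoeff_zero]
  · exact fun k l => ((hA k l).add_right (hAB k l)).add_left ((hAB l k).symm.add_right (hB k l))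
  · have hc : Commute (expSeries K A) (euler (modeSeries B)) := by
      refine commute_of_coeff fun m l => ?_
      rw [coeff_euler, coeff_expSeries]
      refine (Nat.cast_commute l _).symm.mul_right ?_
      simp only [modeSeries, coeff_mk]
      split_ifs
      · exact (commute_expCoeff (fun k => (hAB k _).symm) m).symm
      · exact Commute.zero_right _
    rw [euler_mul, euler_expSeries hA, euler_expSeries hB, hm, euler_add, add_mul, ← mul_assoc,
      ← mul_assoc, ← mul_assoc, hc.eq]

theorem expCoeff_add [CharZero K] {A B : ℕ+ → R} (hA : ∀ k l, Commute (A k) (A l))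
    (hB : ∀ k l, Commute (B k) (B l)) (hAB : ∀ k l, Commute (A k) (B l)) (N : ℕ) :
    expCoeff (K := K) (fun k => A k + B k) N =
      ∑ x ∈ Finset.HasAntidiagonal.antidiagonal N, expCoeff (K := K) A x.1 * expCoeff (K := K) B x.2 := by
  rw [← coeff_expSeries, expSeries_add hA hB hAB, coeff_mul]
  simp only [coeff_expSeries]

theorem expCoeff_mul_pow {A : ℕ+ → R} {u : R} (hu : ∀ k, Commute u (A k)) (N : ℕ) :
    expCoeff (K := K) (fun k => A k * u ^ (k : ℕ)) N = expCoeff (K := K) A N * u ^ N := by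
  have key : ∀ j N, coeff N (modeSeries (fun k => A k * u ^ (k : ℕ)) ^ j) =
      coeff N (modeSeries A ^ j) * u ^ N := by
    intro j
    induction j with
    | zero =>
      intro N
      simp only [pow_zero, coeff_one]
      split_ifs with h <;> simp [h]
    | succ j ih =>
      intro N
      simp only [pow_succ, coeff_mul, Finset.sum_mul]
      refine Finset.sum_congr rfl fun x hx => ?_
      rw [ih, ← Finset.HasAntidiagonal.mem_antidiagonal.mp hx, pow_add]
      simp only [modeSeries, coeff_mk]
      split_ifs with h
      · have h1 := ((hu (x.2.toPNat h)).pow_left x.1).eq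
        have h2 : ((x.2.toPNat h : ℕ+) : ℕ) = x.2 := rfl
        rw [h2, mul_assoc, mul_assoc, ← mul_assoc (u ^ x.1), h1, mul_assoc]
      · simp
  rw [expCoeff_eq_sum _ (Nat.lt_succ_self N), expCoeff_eq_sum A (Nat.lt_succ_self N),
    Finset.sum_mul]
  exact Finset.sum_congr rfl fun j _ => by rw [key, smul_mul_assoc]

/-- If `[a, B_l] = δ_{kl} c` is a scalar, then conjugation by `exp (∑ B_l t ^ l)` moves `a` to
`a + c t ^ k`. -/
theorem C_mul_expSeries [CharZero K] {B : ℕ+ → R} (hB : ∀ k l, Commute (B k) (B l)) {a : R}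
    {k : ℕ+} {c : K}
    (h : ∀ l, a * B l = B l * a + if l = k then algebraMap K R c else 0) :
    C a * expSeries K B =
      expSeries K B * (C a + C (algebraMap K R c) * X ^ (k : ℕ)) := by
  set E := expSeries K B
  set b := modeSeries B
  set t : PowerSeries R := C (algebraMap K R c) * X ^ (k : ℕ)
  have htc : ∀ f : PowerSeries R, f * t = t * f := by
    intro f
    have h1 : Commute f (C (algebraMap K R c)) := by
      refine commute_of_coeff fun m l => ?_
      rw [coeff_C]
      split_ifs
      · exact (Algebra.commutes c _).symm
      · exact Commute.zero_right _
    exact (h1.mul_right ((PowerSeries.commute_X f).pow_right _)).eq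
  have hb : C a * euler b = euler b * C a + (k : PowerSeries R) * t := by
    ext N
    simp only [map_add, coeff_C_mul, coeff_mul_C, coeff_euler, t, ← nsmul_eq_mul, map_nsmul,
      coeff_X_pow, mul_ite, mul_one, mul_zero]
    rcases Nat.eq_zero_or_pos N with rfl | hN
    · simp [k.pos.ne]
    · have h1 := h (N.toPNat hN)
      have h2 : coeff N b = B (N.toPNat hN) := coeff_modeSeries_pnat B (N.toPNat hN)
      rw [h2, mul_smul_comm, h1, smul_add, smul_mul_assoc]
      congr 1
      have h3 : (N.toPNat hN = k) ↔ N = (k : ℕ) := by rw [← PNat.coe_inj]; rfl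
      simp only [h3, smul_ite, smul_zero]
      split_ifs with h4
      · rw [h4]
      · rfl
  have he : euler E = euler b * E := euler_expSeries hB
  have hte : euler t = (k : PowerSeries R) * t := by
    ext N
    simp only [coeff_euler, t, ← nsmul_eq_mul, map_nsmul, coeff_C_mul, coeff_X_pow]
    split_ifs with hN
    · rw [hN]
    · simp
  -- The difference `D = aE - E(a + t)` satisfies `euler D = euler b * D`: the two terms `k t E` and
  -- `E k t` produced by `[a, euler b] = k t` and by `euler t = k t` cancel because `t` is central.
  rw [← sub_eq_zero]
  refine eq_zero_of_euler_eq_mul (K := K) (coeff_zero_euler b) ?_ ?_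
  · have h0 : coeff 0 E = 1 := by rw [coeff_expSeries, expCoeff_zero]
    have h1 : coeff 0 t = 0 := by simp [t, coeff_X_pow, k.pos.ne]
    rw [map_sub, mul_add, map_add, htc, coeff_C_mul, coeff_mul_C, coeff_mul, h0]
    simp [h1]
  · have hkt : E * ((k : PowerSeries R) * t) = (k : PowerSeries R) * t * E := by
      rw [← mul_assoc E, ← (Nat.cast_commute (k : ℕ) E).eq, mul_assoc _ E, htc, ← mul_assoc _ t]
    rw [euler_sub, euler_mul, euler_mul, euler_add, euler_C, hte, he, zero_mul, zero_add, zero_add,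
      ← mul_assoc, hb, hkt]
    noncomm_ring

end ExpCoeff

/-! ### Reordering of two exponentials whose modes have scalar commutators. -/

section Contraction

open PowerSeries

variable {K R : Type*} [Field K] [Ring R] [Algebra K R]

theorem semiconjBy_expSeries [CharZero K] {A B : ℕ+ → R} {c : ℕ+ → K}
    (hB : ∀ k l, Commute (B k) (B l))
    (h : ∀ k l, A k * B l = B l * A k + if l = k then algebraMap K R (c k) else 0) (k : ℕ+) :
    SemiconjBy (expSeries K B) (C (A k) + C (algebraMap K R (c k)) * X ^ (k : ℕ)) (C (A k)) :=
  (C_mul_expSeries hB (h k)).symm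

/-- The constants as a homomorphism of algebras. -/
def constHom (K R : Type*) [Field K] [Ring R] [Algebra K R] : R →ₐ[K] PowerSeries R :=
  { (C : R →+* PowerSeries R) with
    commutes' := fun _ => PowerSeries.algebraMap_apply.symm }

theorem expCoeff_constHom (A : ℕ+ → R) (N : ℕ) :
    expCoeff (K := K) (fun k => (C (A k) : PowerSeries R)) N = C (expCoeff (K := K) A N) :=
  map_expCoeff (constHom K R) A N

theorem expCoeff_algebraMap (c : ℕ+ → K) (N : ℕ) :
    expCoeff (K := K) (fun k => algebraMap K R (c k)) N =
      algebraMap K R (expCoeff (K := K) c N) :=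
  map_expCoeff (Algebra.ofId K R) c N

/-- Exponentials of modes whose commutators are scalars, in the opposite order. -/
theorem expCoeff_mul_expCoeff [CharZero K] {A B : ℕ+ → R} {c : ℕ+ → K}
    (hA : ∀ k l, Commute (A k) (A l)) (hB : ∀ k l, Commute (B k) (B l))
    (h : ∀ k l, A k * B l = B l * A k + if l = k then algebraMap K R (c k) else 0) (j N : ℕ) :
    expCoeff (K := K) A j * expCoeff (K := K) B N =
      ∑ x ∈ Finset.HasAntidiagonal.antidiagonal j,
        if x.2 ≤ N then expCoeff (K := K) c x.2 •
          (expCoeff (K := K) B (N - x.2) * expCoeff (K := K) A x.1) else 0 := by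
  have hX : ∀ (f : PowerSeries R), Commute (X : PowerSeries R) f := fun f =>
    (PowerSeries.commute_X f).symm
  have hs : ∀ (a : K) (f : PowerSeries R), Commute (C (algebraMap K R a)) f := by
    intro a f
    refine commute_of_coeff fun m l => ?_
    rw [coeff_C]
    split_ifs
    · exact Algebra.commutes a _
    · exact Commute.zero_left _
  -- One works in `PowerSeries R`: moving `exp (∑ B_l X^l)` through the `j`-th coefficient of `exp
  -- (∑ A_k s^k)` replaces `A_k` by `A_k + c_k X^k`. The second summand is central, so the
  -- exponential splits, and the coefficient of `X^N` is the claim.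
  have h1 := (semiconjBy_expCoeff (K := K) (semiconjBy_expSeries hB h) j).eq
  have hAC : ∀ k l, Commute (C (A k) : PowerSeries R) (C (A l)) := fun k l => (hA k l).map C
  rw [expCoeff_add hAC
    (fun k l => (hs _ _).mul_left ((hX _).pow_left _))
    (fun k l => ((hs _ _).mul_left ((hX _).pow_left _)).symm)] at h1
  have h2 := congrArg (coeff N) h1
  rw [expCoeff_constHom, coeff_C_mul, coeff_expSeries] at h2
  rw [← h2, Finset.mul_sum, map_sum]
  refine Finset.sum_congr rfl fun x _ => ?_
  have h3 : expCoeff (K := K) (fun k : ℕ+ => (C (algebraMap K R (c k)) * X ^ (k : ℕ) :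
      PowerSeries R)) x.2 = C (algebraMap K R (expCoeff (K := K) c x.2)) * X ^ x.2 := by
    rw [expCoeff_mul_pow (fun k => hX _)]
    congr 1
    have h4 := expCoeff_algebraMap (R := PowerSeries R) c x.2
    simpa only [PowerSeries.algebraMap_apply] using h4
  rw [h3, expCoeff_constHom, ← mul_assoc, ← mul_assoc, coeff_mul_X_pow', coeff_mul_C, coeff_mul_C,
    coeff_expSeries]
  split_ifs
  · rw [Algebra.smul_def, Algebra.commutes]
  · rfl

/-- The coefficient of `z ^ j`, `j ∈ ℤ`, in `exp (∑_{k ≥ 1} A k z ^ k)`. -/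
def expZ (K : Type*) {R : Type*} [Field K] [Ring R] [Algebra K R] (A : ℕ+ → R) (j : ℤ) : R :=
  if 0 ≤ j then expCoeff (K := K) A j.toNat else 0

theorem expZ_natCast (A : ℕ+ → R) (j : ℕ) : expZ K A j = expCoeff (K := K) A j := by
  simp [expZ]

theorem expZ_of_neg (A : ℕ+ → R) {j : ℤ} (h : j < 0) : expZ K A j = 0 :=
  if_neg (not_le.mpr h)

theorem finsum_int_eq_sum_antidiagonal {M : Type*} [AddCommMonoid M] (g : ℤ → M) (j : ℕ)
    (hg : ∀ m : ℤ, m < 0 ∨ (j : ℤ) < m → g m = 0) :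
    ∑ᶠ m, g m = ∑ x ∈ Finset.HasAntidiagonal.antidiagonal j, g x.2 := by
  rw [finsum_eq_sum_of_support_subset (s := (Finset.range (j + 1)).map Nat.castEmbedding),
    Finset.sum_map, ← Finset.Nat.sum_antidiagonal_swap,
    Finset.Nat.sum_antidiagonal_eq_sum_range_succ_mk]
  · rfl
  · intro m hm
    have h1 : ¬ (m < 0 ∨ (j : ℤ) < m) := fun h => hm (hg m h)
    push Not at h1
    simp only [Finset.coe_map, Finset.coe_range, Set.mem_image, Set.mem_Iio]
    exact ⟨m.toNat, by omega, by simp [h1.1]⟩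

/-- With coefficients extended by zero to negative degrees, the reordering formula needs no side
conditions, and later reindexings can be bijections of `ℤ × ℤ × ℤ`. -/
theorem expZ_mul_expZ [CharZero K] {A B : ℕ+ → R} {c : ℕ+ → K}
    (hA : ∀ k l, Commute (A k) (A l)) (hB : ∀ k l, Commute (B k) (B l))
    (h : ∀ k l, A k * B l = B l * A k + if l = k then algebraMap K R (c k) else 0) (j N : ℤ) :
    expZ K A j * expZ K B N =
      ∑ᶠ m : ℤ, expZ K c m • (expZ K B (N - m) * expZ K A (j - m)) := by
  have hz : ∀ m : ℤ, m < 0 ∨ N < m ∨ j < m →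
      expZ K c m • (expZ K B (N - m) * expZ K A (j - m)) = 0 := by
    rintro m (h | h | h)
    · rw [expZ_of_neg _ h, zero_smul]
    · rw [expZ_of_neg B (by omega), zero_mul, smul_zero]
    · rw [expZ_of_neg A (by omega), mul_zero, smul_zero]
  rcases lt_or_ge j 0 with hj | hj
  · rw [expZ_of_neg _ hj, zero_mul, finsum_eq_zero_of_forall_eq_zero]
    exact fun m => hz m (by omega)
  rcases lt_or_ge N 0 with hN | hN
  · rw [expZ_of_neg _ hN, mul_zero, finsum_eq_zero_of_forall_eq_zero]
    exact fun m => hz m (by omega)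
  lift j to ℕ using hj
  lift N to ℕ using hN
  rw [expZ_natCast, expZ_natCast, expCoeff_mul_expCoeff hA hB h,
    finsum_int_eq_sum_antidiagonal _ j fun m hm => hz m (by omega)]
  refine Finset.sum_congr rfl fun x hx => ?_
  have hx' := Finset.HasAntidiagonal.mem_antidiagonal.mp hx
  split_ifs with h1
  · rw [expZ_natCast, show (N : ℤ) - x.2 = ((N - x.2 : ℕ) : ℤ) by omega,
      show (j : ℤ) - x.2 = (x.1 : ℤ) by omega, expZ_natCast, expZ_natCast]
  · rw [hz _ (by omega)]

theorem expZ_add [CharZero K] {A B : ℕ+ → R} (hA : ∀ k l, Commute (A k) (A l))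
    (hB : ∀ k l, Commute (B k) (B l)) (hAB : ∀ k l, Commute (A k) (B l)) (N : ℤ) :
    expZ K (fun k => A k + B k) N = ∑ᶠ l : ℤ, expZ K A (N - l) * expZ K B l := by
  have hz : ∀ m : ℤ, m < 0 ∨ N < m → expZ K A (N - m) * expZ K B m = 0 := by
    rintro m (h | h)
    · rw [expZ_of_neg B h, mul_zero]
    · rw [expZ_of_neg A (by omega), zero_mul]
  rcases lt_or_ge N 0 with hN | hN
  · rw [expZ_of_neg _ hN, finsum_eq_zero_of_forall_eq_zero]
    exact fun m => hz m (by omega)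
  lift N to ℕ using hN
  rw [expZ_natCast, expCoeff_add hA hB hAB, finsum_int_eq_sum_antidiagonal _ N hz]
  refine Finset.sum_congr rfl fun x hx => ?_
  have hx' := Finset.HasAntidiagonal.mem_antidiagonal.mp hx
  rw [show (N : ℤ) - x.2 = (x.1 : ℤ) by omega, expZ_natCast, expZ_natCast]

theorem expZ_smul_pow (A : ℕ+ → R) (u : K) (N : ℤ) :
    expZ K (fun k => u ^ (k : ℕ) • A k) N = u ^ N • expZ K A N := by
  rcases lt_or_ge N 0 with hN | hN
  · rw [expZ_of_neg _ hN, expZ_of_neg _ hN, smul_zero]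
  lift N to ℕ using hN
  have h := expCoeff_mul_pow (K := K) (A := A) (u := algebraMap K R u)
    (fun k => Algebra.commutes u _) N
  simp only [← map_pow, ← Algebra.commutes (u ^ _), ← Algebra.smul_def] at h
  rw [expZ_natCast, expZ_natCast, h, zpow_natCast]

theorem expZ_commute {A B : ℕ+ → R} (h : ∀ k l, Commute (A k) (B l)) (M N : ℤ) :
    Commute (expZ K A M) (expZ K B N) := by
  unfold expZ
  split_ifs
  · exact expCoeff_commute h _ _
  · exact Commute.zero_right _
  · exact Commute.zero_left _
  · exact Commute.zero_left _

/-- `exp (∑_{k ≥ 1} (b ^ k - a ^ k) t ^ k / k) = (1 - a t) / (1 - b t)`. -/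
theorem expCoeff_log_ratio [CharZero K] {c : ℕ+ → K} {a b : K}
    (hc : ∀ k, c k = (b ^ (k : ℕ) - a ^ (k : ℕ)) / ((k : ℕ) : K)) (N : ℕ) :
    expCoeff (K := K) c N = if N = 0 then 1 else b ^ (N - 1) * (b - a) := by
  set g : PowerSeries K := PowerSeries.mk fun N => if N = 0 then 1 else b ^ (N - 1) * (b - a)
  suffices h : expSeries K c = g by
    rw [← coeff_expSeries, h, coeff_mk]
  -- With `P = 1/(1 - bt)` and `Q = 1/(1 - at)`, the logarithmic derivative is `P - Q`; it remains
  -- to check that `(1 - at) P` satisfies the resulting Euler equation.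
  refine eq_of_euler_eq_mul (K := K) (coeff_zero_euler (modeSeries c)) ?_
    (euler_expSeries fun k l => Commute.all _ _) ?_
  · rw [coeff_expSeries, expCoeff_zero, coeff_mk, if_pos rfl]
  · set P : PowerSeries K := PowerSeries.mk fun n => b ^ n
    set Q : PowerSeries K := PowerSeries.mk fun n => a ^ n
    have hP : (1 - C b * X) * P = 1 := by
      ext n
      rw [sub_mul, one_mul, mul_assoc]
      cases n with
      | zero => simp [P]
      | succ n => simp [P, coeff_succ_X_mul, coeff_one, pow_succ']
    have hQ : (1 - C a * X) * Q = 1 := by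
      ext n
      rw [sub_mul, one_mul, mul_assoc]
      cases n with
      | zero => simp [Q]
      | succ n => simp [Q, coeff_succ_X_mul, coeff_one, pow_succ']
    have hg : g = (1 - C a * X) * P := by
      ext n
      cases n with
      | zero => simp [g, P, sub_mul, mul_assoc]
      | succ n => simp [g, P, sub_mul, mul_assoc, coeff_succ_X_mul, pow_succ]; ring
    have hm : euler (modeSeries c) = P - Q := by
      ext n
      rw [coeff_euler]
      rcases Nat.eq_zero_or_pos n with rfl | hn
      · simp [P, Q]
      · have h1 : coeff n (modeSeries c) = c (n.toPNat hn) :=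
          coeff_modeSeries_pnat c (n.toPNat hn)
        have h2 : ((n.toPNat hn : ℕ+) : ℕ) = n := rfl
        have h3 : (n : K) ≠ 0 := by exact_mod_cast hn.ne'
        rw [h1, hc, h2, mul_div_cancel₀ _ h3]
        simp [P, Q]
    have hP' : euler P = C b * X * P * P := by
      have h1 := congrArg euler hP
      have h4 : euler (1 : PowerSeries K) = 0 := by simpa using euler_C (1 : K)
      have h2 : euler (1 - C b * X) = - (C b * X : PowerSeries K) := by
        rw [euler_sub, h4, euler_mul, euler_C, zero_mul, zero_add, zero_sub]
        congr 2
        ext n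
        simp only [coeff_euler, coeff_X]
        split_ifs with h <;> simp [h]
      rw [euler_mul, h2, h4] at h1
      linear_combination P * h1 - euler P * hP
    have h5 : euler (1 - C a * X) = - (C a * X : PowerSeries K) := by
      have h4 : euler (1 : PowerSeries K) = 0 := by simpa using euler_C (1 : K)
      rw [euler_sub, h4, euler_mul, euler_C, zero_mul, zero_add, zero_sub]
      congr 2
      ext n
      simp only [coeff_euler, coeff_X]
      split_ifs with h <;> simp [h]
    rw [hg, hm, euler_mul, h5, hP']
    linear_combination (P) * hQ - (P - C a * X * P) * hP

end Contraction

/-! ### The Heisenberg relations on a sector. -/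

namespace NExp

variable {n : ℕ} {K : Type*} [Field K]

/-- The commutator `[a_{i+1}(k), a_{j+1}(-k)]`. -/
def aPair (p : K) (n : ℕ) (k : ℕ+) (i j : Fin n) : K :=
  qnum p ((k : ℕ) * form (toRat (root n ((i : ℕ) + 1))) (toRat (root n ((j : ℕ) + 1)))) *
    qnum p (-((k : ℕ) : ℚ) / 2) / ((k : ℕ) : K)

/-- The commutator of the annihilation mode of `V` with the creation mode of `W`. -/
def contr (p : K) (V W : NExp n K) (k : ℕ+) : K :=
  ∑ i, ∑ j, V.annA k i * W.creA k j * aPair p n k i j +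
    ∑ i, V.annB k i * W.creB k i * ((k : ℕ) : K)

/-- The linear form in the creation operators which is the creation mode of `V`. -/
def creElt (V : NExp n K) (k : ℕ+) : Sector n K :=
  ∑ i, (V.creA k i • MvPolynomial.X (Sum.inl (i, k)) + V.creB k i • MvPolynomial.X (Sum.inr (i, k)))

/-- Creation modes are multiplications by linear forms and annihilation modes are derivations, so
their commutator is multiplication by the derivative of a linear form: a scalar, by the Leibniz
rule. -/
theorem creMode_eq (V : NExp n K) (k : ℕ+) : V.creMode k = LinearMap.mulLeft K (V.creElt k) := by
  refine LinearMap.ext fun f => ?_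
  simp [creMode, creElt, aNeg, bNeg, LinearMap.sum_apply, Finset.sum_mul, add_mul]

/-- The annihilation mode of `V` as a derivation. -/
def annDer (p : K) (V : NExp n K) (k : ℕ+) : Derivation K (Sector n K) (Sector n K) :=
  ∑ i, (V.annA k i • ∑ j, aPair p n k i j • MvPolynomial.pderiv (Sum.inl (j, k)) +
    V.annB k i • ((k : ℕ) : K) • MvPolynomial.pderiv (Sum.inr (i, k)))

theorem derivation_sum_apply {ι : Type*} (s : Finset ι)
    (D : ι → Derivation K (Sector n K) (Sector n K)) (f : Sector n K) :
    (∑ i ∈ s, D i) f = ∑ i ∈ s, D i f := by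
  classical
  induction s using Finset.induction_on with
  | empty => simp
  | insert a s ha ih => simp [Finset.sum_insert ha, ih]

theorem annMode_apply (p : K) (V : NExp n K) (k : ℕ+) (f : Sector n K) :
    V.annMode p k f = V.annDer p k f := by
  simp [annMode, annDer, aPos, bPos, LinearMap.sum_apply, derivation_sum_apply, aPair]

theorem annDer_X_inl (p : K) (V : NExp n K) (k l : ℕ+) (j : Fin n) :
    V.annDer p k (MvPolynomial.X (Sum.inl (j, l))) =
      if l = k then MvPolynomial.C (∑ i, V.annA k i * aPair p n k i j) else 0 := by
  have h : ∀ i, (∑ x, aPair p n k i x •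
      (MvPolynomial.pderiv (Sum.inl (x, k)) : Derivation K (Sector n K) (Sector n K))
        (MvPolynomial.X (Sum.inl (j, l)))) =
      if l = k then MvPolynomial.C (aPair p n k i j) else 0 := by
    intro i
    rw [Finset.sum_eq_single j]
    · simp [MvPolynomial.pderiv_X, Pi.single_apply, MvPolynomial.smul_eq_C_mul]
    · intro b _ hb
      simp [MvPolynomial.pderiv_X, hb.symm]
    · simp
  simp only [annDer, derivation_sum_apply, Derivation.add_apply, Derivation.smul_apply, h]
  split_ifs with hl
  · simp [MvPolynomial.pderiv_X, MvPolynomial.smul_eq_C_mul]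
  · simp [MvPolynomial.pderiv_X]

theorem annDer_X_inr (p : K) (V : NExp n K) (k l : ℕ+) (j : Fin n) :
    V.annDer p k (MvPolynomial.X (Sum.inr (j, l))) =
      if l = k then MvPolynomial.C (V.annB k j * ((k : ℕ) : K)) else 0 := by
  simp only [annDer, derivation_sum_apply, Derivation.add_apply, Derivation.smul_apply]
  rw [Finset.sum_eq_single j]
  · simp [MvPolynomial.pderiv_X, Pi.single_apply, MvPolynomial.smul_eq_C_mul]
  · intro b _ hb
    simp [MvPolynomial.pderiv_X, hb.symm]
  · simp

theorem annDer_creElt (p : K) (V W : NExp n K) (k l : ℕ+) :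
    V.annDer p k (W.creElt l) = if l = k then MvPolynomial.C (contr p V W k) else 0 := by
  simp only [creElt, map_sum, map_add, Derivation.map_smul, annDer_X_inl, annDer_X_inr]
  split_ifs with h
  · subst h
    simp only [contr, MvPolynomial.smul_eq_C_mul, ← map_mul, ← map_add, ← map_sum]
    congr 1
    rw [Finset.sum_add_distrib, Finset.sum_comm]
    congr 1
    · refine Finset.sum_congr rfl fun j _ => ?_
      rw [Finset.mul_sum]
      exact Finset.sum_congr rfl fun i _ => by ring
    · exact Finset.sum_congr rfl fun i _ => by ring
  · simp

theorem creMode_commute (V W : NExp n K) (k l : ℕ+) : Commute (V.creMode k) (W.creMode l) := by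
  rw [creMode_eq, creMode_eq]
  refine LinearMap.ext fun f => ?_
  simp only [Module.End.mul_apply, LinearMap.mulLeft_apply]
  ring

/-- Both derivations send variables to constants, so their commutator, again a derivation, kills all
variables. -/
theorem annMode_commute (p : K) (V W : NExp n K) (k l : ℕ+) :
    Commute (V.annMode p k) (W.annMode p l) := by
  have h : ⁅V.annDer p k, W.annDer p l⁆ = 0 := by
    refine MvPolynomial.derivation_ext fun v => ?_
    rcases v with ⟨j, m⟩ | ⟨j, m⟩
    · simp only [Derivation.commutator_apply, annDer_X_inl]
      split_ifs <;> simp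
    · simp only [Derivation.commutator_apply, annDer_X_inr]
      split_ifs <;> simp
  refine LinearMap.ext fun f => ?_
  simp only [Module.End.mul_apply, annMode_apply]
  have h1 := congrArg (fun D : Derivation K (Sector n K) (Sector n K) => D f) h
  simp only [Derivation.commutator_apply, Derivation.zero_apply] at h1
  exact sub_eq_zero.mp h1

theorem annMode_mul_creMode (p : K) (V W : NExp n K) (k l : ℕ+) :
    V.annMode p k * W.creMode l = W.creMode l * V.annMode p k +
      if l = k then algebraMap K (Module.End K (Sector n K)) (contr p V W k) else 0 := by
  refine LinearMap.ext fun f => ?_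
  rw [creMode_eq]
  simp only [Module.End.mul_apply, annMode_apply, LinearMap.mulLeft_apply, Derivation.leibniz,
    annDer_creElt, smul_eq_mul, LinearMap.add_apply]
  split_ifs with h
  · simp [MvPolynomial.smul_eq_C_mul, mul_comm]
  · simp

end NExp

/-! ### Products of oscillator exponentials as normally ordered sums. -/

namespace NExp

variable {n : ℕ} {K : Type*} [Field K]

/-- The coefficient of `z ^ j` in the creation exponential. -/
def cre (V : NExp n K) (j : ℤ) : Module.End K (Sector n K) := expZ K V.creMode j

/-- The coefficient of `z ^ (-j)` in the annihilation exponential. -/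
def ann (p : K) (V : NExp n K) (j : ℤ) : Module.End K (Sector n K) := expZ K (V.annMode p) j

theorem cre_of_neg (V : NExp n K) {j : ℤ} (h : j < 0) : V.cre j = 0 := expZ_of_neg _ h

theorem ann_of_neg (p : K) (V : NExp n K) {j : ℤ} (h : j < 0) : V.ann p j = 0 := expZ_of_neg _ h

theorem degLE_of_neg {M : ℤ} (hM : M < 0) : degLE n K M = ⊥ := by
  rw [degLE, Submodule.span_eq_bot]
  rintro _ ⟨s, hs, -⟩
  omega

theorem ann_mem_degLE (p : K) (V : NExp n K) (j M : ℤ) {f : Sector n K} (hf : f ∈ degLE n K M) :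
    V.ann p j f ∈ degLE n K (M - j) := by
  rcases lt_or_ge j 0 with hj | hj
  · rw [ann_of_neg p V hj]
    exact Submodule.zero_mem _
  lift j to ℕ using hj
  rw [ann, expZ_natCast]
  exact lowers_expCoeff _ (lowers_annMode p V) j M f hf

theorem exists_ann_eq_zero (p : K) (V : NExp n K) (f : Sector n K) :
    ∃ B : ℤ, ∀ k, B < k → V.ann p k f = 0 := by
  obtain ⟨M, hM⟩ := exists_mem_degLE f
  refine ⟨M, fun k hk => ?_⟩
  have h := ann_mem_degLE p V k M hM
  rwa [degLE_of_neg (by omega), Submodule.mem_bot] at h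

theorem exists_ann_ann_eq_zero (p : K) (V W : NExp n K) (f : Sector n K) :
    ∃ B : ℤ, ∀ k l, B < k + l → V.ann p k (W.ann p l f) = 0 := by
  obtain ⟨M, hM⟩ := exists_mem_degLE f
  refine ⟨M, fun k l hk => ?_⟩
  have h := ann_mem_degLE p V k _ (ann_mem_degLE p W l M hM)
  rwa [degLE_of_neg (by omega), Submodule.mem_bot] at h

/-- For fixed `d` a pair `(j, k)` with `j - k = d` is determined by `k`; terms with a negative
degree vanish. -/
theorem osc_apply (p : K) (V : NExp n K) (d : ℤ) (f : Sector n K) :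
    V.osc p d f = ∑ᶠ k : ℤ, V.cre (d + k) (V.ann p k f) := by
  change ∑ᶠ x : ℕ × ℕ, V.oscTerm p d x f = _
  have key : ∀ x : ℕ × ℕ, (x.1 : ℤ) - x.2 = d →
      V.oscTerm p d x f = V.cre (d + x.2) (V.ann p x.2 f) := by
    intro x hx
    have h1 : (x.1 : ℚ) - (x.2 : ℚ) = (d : ℚ) := by rw [← hx]; push_cast; rfl
    rw [oscTerm, if_pos h1, ← hx, sub_add_cancel, cre, ann, expZ_natCast, expZ_natCast]
    rfl
  have hd : ∀ x : ℕ × ℕ, V.oscTerm p d x f ≠ 0 → (x.1 : ℤ) - x.2 = d := by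
    intro x hx
    by_contra hne
    refine hx ?_
    rw [oscTerm, if_neg, LinearMap.zero_apply]
    intro h
    exact hne (by exact_mod_cast h)
  rw [← finsum_mem_support, ← finsum_mem_support (f := fun k : ℤ => V.cre (d + k) (V.ann p k f))]
  refine finsum_mem_eq_of_bijOn (fun x => (x.2 : ℤ)) ⟨?_, ?_, ?_⟩ ?_
  · intro x hx
    have h := key x (hd x hx)
    rw [Function.mem_support] at hx ⊢
    rwa [← h]
  · intro x hx y hy hxy
    have h1 := hd x hx
    have h2 := hd y hy
    have h3 : (x.2 : ℤ) = y.2 := hxy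
    exact Prod.ext (by omega) (by omega)
  · intro k hk
    rw [Function.mem_support] at hk
    have hk0 : 0 ≤ k := by
      by_contra h
      rw [ann_of_neg p V (by omega)] at hk
      simp at hk
    have hk1 : 0 ≤ d + k := by
      by_contra h
      rw [cre_of_neg V (by omega)] at hk
      simp at hk
    refine ⟨((d + k).toNat, k.toNat), ?_, by simp [hk0]⟩
    rw [Function.mem_support, key _ (by simp; omega)]
    simpa [hk0] using hk
  · intro x hx
    exact key x (hd x hx)

theorem osc_eq_zero (p : K) (V : NExp n K) {d : ℚ} (hd : ∀ d' : ℤ, (d' : ℚ) ≠ d) :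
    V.osc p d = 0 := by
  refine LinearMap.ext fun f => ?_
  change ∑ᶠ x : ℕ × ℕ, V.oscTerm p d x f = 0
  refine finsum_eq_zero_of_forall_eq_zero fun x => ?_
  rw [oscTerm, if_neg, LinearMap.zero_apply]
  intro h
  exact hd (x.1 - x.2) (by push_cast; exact h)

/-- The terms of `∑_m g m :V(z)W(w):_{d + m, e - m}` applied to `f`. -/
def normalTerm (p : K) (V W : NExp n K) (g : ℤ → K) (d e : ℤ) (f : Sector n K)
    (x : ℤ × ℤ × ℤ) : Sector n K :=
  g x.1 • V.cre (d + x.1 + x.2.1) (W.cre (e - x.1 + x.2.2) (V.ann p x.2.1 (W.ann p x.2.2 f)))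

/-- Two annihilation coefficients of total degree beyond that of `f` kill it, which bounds `k` and
`l`; nonnegativity of the two creation degrees then bounds `m` on both sides. No support condition
on `g` is needed, so bilateral series such as a delta function are allowed. -/
theorem normalTerm_finite (p : K) (V W : NExp n K) (g : ℤ → K) (d e : ℤ) (f : Sector n K) :
    (Function.support (normalTerm p V W g d e f)).Finite := by
  obtain ⟨B, hB⟩ := exists_ann_ann_eq_zero p V W f
  refine ((Set.finite_Icc (-d - B) (e + B)).prod
    ((Set.finite_Icc 0 B).prod (Set.finite_Icc 0 B))).subset ?_
  rintro ⟨m, k, l⟩ hx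
  by_contra hmem
  refine hx ?_
  simp only [normalTerm]
  have h1 : ¬ (0 ≤ k ∧ 0 ≤ l ∧ k + l ≤ B ∧ 0 ≤ d + m + k ∧ 0 ≤ e - m + l) := by
    rintro ⟨h1, h2, h3, h4, h5⟩
    exact hmem ⟨⟨by simp only; omega, by simp only; omega⟩,
      ⟨by simp only; omega, by simp only; omega⟩, ⟨by simp only; omega, by simp only; omega⟩⟩
  by_cases hk : k < 0
  · simp [ann_of_neg p V hk]
  by_cases hl : l < 0
  · simp [ann_of_neg p W hl]
  by_cases hkl : B < k + l
  · simp [hB k l hkl]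
  by_cases h4 : d + m + k < 0
  · simp [cre_of_neg V h4]
  by_cases h5 : e - m + l < 0
  · simp [cre_of_neg W h5]
  exact absurd ⟨by omega, by omega, by omega, by omega, by omega⟩ h1

/-- The coefficient of `z ^ d w ^ e` in `∑_m g m (w / z) ^ m :V(z)W(w):`, applied to `f`. -/
def normalSum (p : K) (V W : NExp n K) (g : ℤ → K) (d e : ℤ) (f : Sector n K) : Sector n K :=
  ∑ᶠ x, normalTerm p V W g d e f x

theorem normalSum_smul_sub_smul (p : K) (V W : NExp n K) (a b : K) (g h : ℤ → K) (d e : ℤ)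
    (f : Sector n K) :
    a • normalSum p V W g d e f - b • normalSum p V W h d e f =
      normalSum p V W (fun m => a * g m - b * h m) d e f := by
  have h1 : ∀ (c : K) (g : ℤ → K), c • normalSum p V W g d e f =
      normalSum p V W (fun m => c * g m) d e f := by
    intro c g
    rw [normalSum, smul_finsum' c (normalTerm_finite p V W g d e f), normalSum]
    exact finsum_congr fun x => by simp only [normalTerm, mul_smul]
  rw [h1, h1, normalSum, normalSum, ← finsum_sub_distrib (normalTerm_finite ..)
    (normalTerm_finite ..)]
  exact finsum_congr fun x => by simp only [normalTerm, sub_smul]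

/-- Multiplication by `z/w` can be absorbed into the scalar series. -/
theorem normalSum_shift (p : K) (V W : NExp n K) (g : ℤ → K) (d e : ℤ) (f : Sector n K) :
    normalSum p V W g (d - 1) (e + 1) f = normalSum p V W (fun m => g (m + 1)) d e f := by
  rw [normalSum, normalSum,
    ← finsum_comp_equiv ((Equiv.addRight (1 : ℤ)).prodCongr (Equiv.refl (ℤ × ℤ)))]
  refine finsum_congr fun x => ?_
  simp only [normalTerm, Equiv.prodCongr_apply, Prod.map, Equiv.coe_addRight, Equiv.refl_apply]
  rw [show d - 1 + (x.1 + 1) = d + x.1 by ring, show e + 1 - (x.1 + 1) = e - x.1 by ring]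

/-- The reindexing `(k, l, m) ↦ (m, k - m, l)`. -/
def shearEquiv : ℤ × ℤ × ℤ ≃ ℤ × ℤ × ℤ where
  toFun x := (x.2.2, x.1 - x.2.2, x.2.1)
  invFun x := (x.2.1 + x.1, x.2.2, x.1)
  left_inv x := by simp
  right_inv x := by simp

theorem map_finsum_apply {ι M N : Type*} [AddCommGroup M] [Module K M] [AddCommGroup N]
    [Module K N] (T : M →ₗ[K] N) {g : ι → M} (hg : (Function.support g).Finite) :
    T (∑ᶠ i, g i) = ∑ᶠ i, T (g i) :=
  T.toAddMonoidHom.map_finsum hg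

theorem finsum_end_apply {ι M : Type*} [AddCommGroup M] [Module K M] {T : ι → Module.End K M}
    (hT : (Function.support T).Finite) (f : M) : (∑ᶠ i, T i) f = ∑ᶠ i, T i f :=
  map_finsum_apply (LinearMap.applyₗ (R := K) (M₂ := M) f) hT

theorem ann_mul_cre [CharZero K] (p : K) (V W : NExp n K) (j N : ℤ) (f : Sector n K) :
    V.ann p j (W.cre N f) =
      ∑ᶠ m : ℤ, expZ K (contr p V W) m • W.cre (N - m) (V.ann p (j - m) f) := by
  have h := expZ_mul_expZ (K := K) (annMode_commute p V V) (creMode_commute W W)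
    (annMode_mul_creMode p V W) j N
  change (V.ann p j * W.cre N) f = _
  rw [ann, cre, h, finsum_end_apply]
  · rfl
  · refine (Set.finite_Icc 0 N).subset fun m hm => ?_
    by_contra hmem
    refine hm ?_
    simp only [Set.mem_Icc, not_and_or, not_le] at hmem
    rcases hmem with h | h
    · simp [expZ_of_neg _ h]
    · simp [expZ_of_neg _ (show N - m < 0 by omega)]

theorem osc_finite (p : K) (V : NExp n K) (d : ℤ) (f : Sector n K) :
    (Function.support fun k : ℤ => V.cre (d + k) (V.ann p k f)).Finite := by
  obtain ⟨B, hB⟩ := exists_ann_eq_zero p V f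
  refine (Set.finite_Icc 0 B).subset fun k hk => ?_
  by_contra hmem
  refine hk ?_
  simp only [Set.mem_Icc, not_and_or, not_le] at hmem
  rcases hmem with h | h
  · simp [ann_of_neg p V h]
  · simp [hB k h]

/-- Wick's rule: only the annihilation part of `V` has to cross the creation part of `W`, and each
crossing of weight `m` moves `m` units of degree from one variable to the other. -/
theorem osc_mul_osc [CharZero K] (p : K) (V W : NExp n K) (d e : ℤ) (f : Sector n K) :
    V.osc p d (W.osc p e f) = normalSum p V W (expZ K (contr p V W)) d e f := by
  rw [normalSum, ← finsum_comp_equiv shearEquiv, finsum_curry₃, osc_apply]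
  · refine finsum_congr fun k => ?_
    rw [osc_apply, map_finsum_apply _ (osc_finite p W e f), map_finsum_apply]
    · refine finsum_congr fun l => ?_
      rw [ann_mul_cre, map_finsum_apply]
      · refine finsum_congr fun m => ?_
        rw [map_smul, normalTerm, shearEquiv]
        simp only [Equiv.coe_fn_mk]
        rw [show d + m + (k - m) = d + k by ring, show e - m + l = e + l - m by ring]
      · refine (Set.finite_Icc 0 k).subset fun m hm => ?_
        by_contra hmem
        refine hm ?_
        simp only [Set.mem_Icc, not_and_or, not_le] at hmem
        rcases hmem with h | h
        · simp [expZ_of_neg _ h]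
        · simp [ann_of_neg p V (show k - m < 0 by omega)]
    · refine (osc_finite p W e f).subset fun l hl h0 => hl ?_
      simp only [h0, map_zero]
  · exact (normalTerm_finite p V W _ d e f).preimage shearEquiv.injective.injOn

/-- The reindexing `(m, k, l) ↦ (-m, l, k)`. -/
def swapEquiv : ℤ × ℤ × ℤ ≃ ℤ × ℤ × ℤ where
  toFun x := (-x.1, x.2.2, x.2.1)
  invFun x := (-x.1, x.2.2, x.2.1)
  left_inv x := by simp
  right_inv x := by simp

/-- The normally ordered product is symmetric in its factors, so both orders of multiplication are
expressed through one product; the scalar series only has `w/z` inverted. -/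
theorem normalSum_swap (p : K) (V W : NExp n K) (g : ℤ → K) (d e : ℤ) (f : Sector n K) :
    normalSum p W V g e d f = normalSum p V W (fun m => g (-m)) d e f := by
  rw [normalSum, normalSum, ← finsum_comp_equiv swapEquiv]
  refine finsum_congr fun x => ?_
  simp only [normalTerm, swapEquiv, Equiv.coe_fn_mk]
  have h1 : ∀ i j h, W.cre i (V.cre j h) = V.cre j (W.cre i h) := fun i j h =>
    LinearMap.congr_fun (expZ_commute (creMode_commute W V) i j).eq h
  have h2 : ∀ i j h, W.ann p i (V.ann p j h) = V.ann p j (W.ann p i h) := fun i j h =>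
    LinearMap.congr_fun (expZ_commute (annMode_commute p W V) i j).eq h
  rw [h1, h2, sub_neg_eq_add, ← sub_eq_add_neg]

theorem osc_mul_osc_swap [CharZero K] (p : K) (V W : NExp n K) (d e : ℤ) (f : Sector n K) :
    W.osc p e (V.osc p d f) = normalSum p V W (fun m => expZ K (contr p W V) (-m)) d e f := by
  rw [osc_mul_osc, normalSum_swap]

/-- The exponential `V(u z)`, up to its zero mode. -/
def dilate (u : K) (V : NExp n K) : NExp n K :=
  { V with
    creA := fun k i => u ^ (k : ℕ) * V.creA k i
    creB := fun k i => u ^ (k : ℕ) * V.creB k i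
    annA := fun k i => u⁻¹ ^ (k : ℕ) * V.annA k i
    annB := fun k i => u⁻¹ ^ (k : ℕ) * V.annB k i }

theorem creMode_mul (V W : NExp n K) :
    (V * W).creMode = fun k => V.creMode k + W.creMode k := by
  funext k
  simp only [creMode, ← Finset.sum_add_distrib]
  refine Finset.sum_congr rfl fun i _ => ?_
  change (V.creA k i + W.creA k i) • _ + (V.creB k i + W.creB k i) • _ = _
  rw [add_smul, add_smul]
  abel

theorem annMode_mul (p : K) (V W : NExp n K) :
    (V * W).annMode p = fun k => V.annMode p k + W.annMode p k := by
  funext k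
  simp only [annMode, ← Finset.sum_add_distrib]
  refine Finset.sum_congr rfl fun i _ => ?_
  change (V.annA k i + W.annA k i) • _ + (V.annB k i + W.annB k i) • _ = _
  rw [add_smul, add_smul]
  abel

theorem creMode_dilate (u : K) (V : NExp n K) :
    (V.dilate u).creMode = fun k : ℕ+ => u ^ (k : ℕ) • V.creMode k := by
  funext k
  simp only [creMode, dilate, Finset.smul_sum, smul_add, smul_smul]

theorem annMode_dilate (p u : K) (V : NExp n K) :
    (V.dilate u).annMode p = fun k : ℕ+ => u⁻¹ ^ (k : ℕ) • V.annMode p k := by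
  funext k
  simp only [annMode, dilate, Finset.smul_sum, smul_add, smul_smul]

theorem cre_mul_dilate [CharZero K] (u : K) (V W : NExp n K) (N : ℤ) (f : Sector n K) :
    (V * W.dilate u).cre N f = ∑ᶠ b : ℤ, u ^ b • V.cre (N - b) (W.cre b f) := by
  rw [cre, creMode_mul, expZ_add (creMode_commute V V) (creMode_commute _ _)
    (creMode_commute V _), finsum_end_apply]
  · refine finsum_congr fun b => ?_
    rw [creMode_dilate, expZ_smul_pow, mul_smul_comm]
    rfl
  · refine (Set.finite_Icc 0 N).subset fun m hm => ?_
    by_contra hmem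
    refine hm ?_
    simp only [Set.mem_Icc, not_and_or, not_le] at hmem
    rcases hmem with h | h
    · simp [expZ_of_neg _ h]
    · simp [expZ_of_neg _ (show N - m < 0 by omega)]

theorem ann_mul_dilate [CharZero K] (p u : K) (V W : NExp n K) (N : ℤ) (f : Sector n K) :
    (V * W.dilate u).ann p N f = ∑ᶠ l : ℤ, u⁻¹ ^ l • V.ann p (N - l) (W.ann p l f) := by
  rw [ann, annMode_mul, expZ_add (annMode_commute p V V) (annMode_commute p _ _)
    (annMode_commute p V _), finsum_end_apply]
  · refine finsum_congr fun b => ?_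
    rw [annMode_dilate, expZ_smul_pow, mul_smul_comm]
    rfl
  · refine (Set.finite_Icc 0 N).subset fun m hm => ?_
    by_contra hmem
    refine hm ?_
    simp only [Set.mem_Icc, not_and_or, not_le] at hmem
    rcases hmem with h | h
    · simp [expZ_of_neg _ h]
    · simp [expZ_of_neg _ (show N - m < 0 by omega)]

/-- The reindexing `(N, b, l) ↦ (e + l - b, N - l, l)`. -/
def deltaEquiv (e : ℤ) : ℤ × ℤ × ℤ ≃ ℤ × ℤ × ℤ where
  toFun x := (e + x.2.2 - x.2.1, x.1 - x.2.2, x.2.2)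
  invFun x := (x.2.1 + x.2.2, e + x.2.2 - x.1, x.2.2)
  left_inv x := by simp
  right_inv x := by simp

/-- The product with the delta function `∑_m (w / (u z)) ^ m` only depends on the restriction
to `w = u z`. -/
theorem normalSum_delta [CharZero K] (p : K) {u : K} (hu : u ≠ 0) (V W : NExp n K) (d e : ℤ)
    (f : Sector n K) :
    normalSum p V W (fun m => u⁻¹ ^ m) d e f =
      u⁻¹ ^ e • (V * W.dilate u).osc p (d + e : ℤ) f := by
  rw [normalSum, ← finsum_comp_equiv (deltaEquiv e), finsum_curry₃, osc_apply,
    smul_finsum' _ (osc_finite _ _ _ _)]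
  · refine finsum_congr fun N => ?_
    rw [cre_mul_dilate, smul_finsum']
    · refine finsum_congr fun b => ?_
      rw [ann_mul_dilate, map_finsum_apply, map_finsum_apply, smul_finsum', smul_finsum']
      · refine finsum_congr fun l => ?_
        simp only [normalTerm, deltaEquiv, Equiv.coe_fn_mk, map_smul, smul_smul]
        -- The weight `u^{-(e+l-b)}` splits as `u^{-e}`, an overall factor, `u^b` and `u^{-l}`,
        -- which are the dilations of the creation and annihilation parts of `W`.
        rw [show d + (e + l - b) + (N - l) = d + e + N - b by ring,
          show e - (e + l - b) + l = b by ring, zpow_sub₀ (inv_ne_zero hu),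
          zpow_add₀ (inv_ne_zero hu)]
        congr 1
        simp
        ring
      all_goals
        refine (Set.finite_Icc 0 N).subset fun m hm => ?_
        by_contra hmem
        refine hm ?_
        simp only [Set.mem_Icc, not_and_or, not_le] at hmem
        rcases hmem with h | h
        · simp [ann_of_neg p W h]
        · simp [ann_of_neg p V (show N - m < 0 by omega)]
    · refine (Set.finite_Icc 0 (d + e + N)).subset fun m hm => ?_
      by_contra hmem
      refine hm ?_
      simp only [Set.mem_Icc, not_and_or, not_le] at hmem
      rcases hmem with h | h
      · simp [cre_of_neg W h]
      · simp [cre_of_neg V (show d + e + N - m < 0 by omega)]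
  · exact (normalTerm_finite p V W _ d e f).preimage (deltaEquiv e).injective.injOn

end NExp

/-! ### Zero modes, and commutators of full vertex operators. -/

/-- The sector reached from `w` by a translation of the charges. -/
def Charge.shift {n : ℕ} (w : Charge n) (a b : Fin n → ℤ) : Charge n := (w.1, w.2.1 + a, w.2.2 + b)

theorem Charge.shift_shift {n : ℕ} (w : Charge n) (a b a' b' : Fin n → ℤ) :
    (w.shift a b).shift a' b' = w.shift (a + a') (b + b') := by
  simp [Charge.shift, add_assoc]

namespace NExp

variable {n : ℕ} {K : Type*} [Field K]

theorem series_single (p : K) (V : NExp n K) (r : ℚ) (w : Charge n) (f : Sector n K) :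
    V.series p r (Finsupp.single w f) =
      Finsupp.single (w.shift V.shA V.shB) (V.scal w • V.osc p (r - V.pow w) f) := by
  simp [series, Charge.shift]

/-- The contraction of `V` with `W`: their modes have commutators `c`, and moving the zero modes of
`V` through the translation operator of `W` produces `κ z ^ t`. -/
structure HasContr (p : K) (V W : NExp n K) (c : ℕ+ → K) (t : ℚ) (κ : K) : Prop where
  contr_eq : ∀ k, contr p V W k = c k
  pow_shift : ∀ w : Charge n, V.pow (w.shift W.shA W.shB) = V.pow w + t
  scal_shift : ∀ w : Charge n, V.scal (w.shift W.shA W.shB) = κ * V.scal w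

theorem HasContr.congr {p : K} {V W : NExp n K} {c c' : ℕ+ → K} {t t' : ℚ} {κ κ' : K}
    (h : HasContr p V W c t κ) (hc : ∀ k, c k = c' k) (ht : t = t') (hκ : κ = κ') :
    HasContr p V W c' t' κ' := by
  obtain rfl : c = c' := funext hc
  rwa [← ht, ← hκ]

/-- Mode commutators and powers add while zero-mode constants multiply; with its right-hand analogue
this reduces all contractions to those of the elementary factors `phiA`, `Z` and `Y`. -/
theorem HasContr.mul_left {p : K} {V V' W : NExp n K} {c c' : ℕ+ → K} {t t' : ℚ} {κ κ' : K}
    (h : HasContr p V W c t κ) (h' : HasContr p V' W c' t' κ') :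
    HasContr p (V * V') W (fun k => c k + c' k) (t + t') (κ * κ') where
  contr_eq k := by
    rw [← h.contr_eq, ← h'.contr_eq]
    change ∑ i, ∑ j, (V.annA k i + V'.annA k i) * _ * _ + ∑ i, (V.annB k i + V'.annB k i) * _ * _ = _
    simp only [contr, add_mul, Finset.sum_add_distrib]
    ring
  pow_shift w := by
    change V.pow _ + V'.pow _ = V.pow w + V'.pow w + _
    rw [h.pow_shift, h'.pow_shift]
    ring
  scal_shift w := by
    change V.scal _ * V'.scal _ = _ * (V.scal w * V'.scal w)
    rw [h.scal_shift, h'.scal_shift]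
    ring

theorem HasContr.mul_right {p : K} {V W W' : NExp n K} {c c' : ℕ+ → K} {t t' : ℚ} {κ κ' : K}
    (h : HasContr p V W c t κ) (h' : HasContr p V W' c' t' κ') :
    HasContr p V (W * W') (fun k => c k + c' k) (t + t') (κ * κ') where
  contr_eq k := by
    rw [← h.contr_eq, ← h'.contr_eq]
    change ∑ i, ∑ j, _ * (W.creA k j + W'.creA k j) * _ + ∑ i, _ * (W.creB k i + W'.creB k i) * _ = _
    simp only [contr, mul_add, add_mul, Finset.sum_add_distrib]
    ring
  pow_shift w := by
    change V.pow (w.shift (W.shA + W'.shA) (W.shB + W'.shB)) = _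
    rw [← Charge.shift_shift, h'.pow_shift, h.pow_shift]
    ring
  scal_shift w := by
    change V.scal (w.shift (W.shA + W'.shA) (W.shB + W'.shB)) = _
    rw [← Charge.shift_shift, h'.scal_shift, h.scal_shift]
    ring

/-- The coefficient of `(w / z) ^ m` in the scalar factor of `[V(z), W(w)]_v`. -/
def commFactor (v : K) (c c' : ℕ+ → K) (κ κ' : K) (m : ℤ) : K :=
  κ * expZ K c m - v * κ' * expZ K c' (-m)

variable {p : K} {V W : NExp n K} {c c' : ℕ+ → K} {κ κ' : K}

theorem qcomm_single (hVW : HasContr p V W c 0 κ) (hWV : HasContr p W V c' 0 κ') (v : K) (r s : ℚ)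
    (w : Charge n) (f : Sector n K) :
    qcomm v (V.series p) (W.series p) r s (Finsupp.single w f) =
      Finsupp.single (w.shift (V.shA + W.shA) (V.shB + W.shB)) ((V.scal w * W.scal w) •
        (κ • V.osc p (r - V.pow w) (W.osc p (s - W.pow w) f) -
          (v * κ') • W.osc p (s - W.pow w) (V.osc p (r - V.pow w) f))) := by
  simp only [qcomm, LinearMap.sub_apply, LinearMap.smul_apply, Module.End.mul_apply, series_single,
    hVW.pow_shift, hVW.scal_shift, hWV.pow_shift, hWV.scal_shift, add_zero, Charge.shift_shift,
    map_smul, Finsupp.smul_single]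
  rw [add_comm W.shA, add_comm W.shB, ← Finsupp.single_sub]
  congr 1
  simp only [smul_sub, smul_smul]
  congr 2 <;> ring

theorem qcomm_single_of_int [CharZero K] (hVW : HasContr p V W c 0 κ) (hWV : HasContr p W V c' 0 κ')
    (v : K) {r s : ℚ} {w : Charge n} {d e : ℤ} (hd : (d : ℚ) = r - V.pow w)
    (he : (e : ℚ) = s - W.pow w) (f : Sector n K) :
    qcomm v (V.series p) (W.series p) r s (Finsupp.single w f) =
      Finsupp.single (w.shift (V.shA + W.shA) (V.shB + W.shB)) ((V.scal w * W.scal w) •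
        normalSum p V W (commFactor v c c' κ κ') d e f) := by
  have h1 : contr p V W = c := funext hVW.contr_eq
  have h2 : contr p W V = c' := funext hWV.contr_eq
  rw [qcomm_single hVW hWV, ← hd, ← he, osc_mul_osc, osc_mul_osc_swap, normalSum_smul_sub_smul,
    h1, h2]
  rfl

/-- On each sector the exponents of a vertex operator lie in a single coset of `ℤ`, so all other
coefficients vanish. -/
theorem qcomm_single_of_not_int (hVW : HasContr p V W c 0 κ) (hWV : HasContr p W V c' 0 κ')
    (v : K) {r s : ℚ} {w : Charge n}
    (h : ¬ ((∃ d : ℤ, (d : ℚ) = r - V.pow w) ∧ ∃ e : ℤ, (e : ℚ) = s - W.pow w)) (f : Sector n K) :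
    qcomm v (V.series p) (W.series p) r s (Finsupp.single w f) = 0 := by
  rw [qcomm_single hVW hWV]
  rw [not_and_or] at h
  rcases h with h | h
  · rw [osc_eq_zero p V fun d hd => h ⟨d, hd⟩]
    simp
  · rw [osc_eq_zero p W fun d hd => h ⟨d, hd⟩]
    simp

theorem end_ext {S T : Module.End K (Fock n K)}
    (h : ∀ w f, S (Finsupp.single w f) = T (Finsupp.single w f)) : S = T :=
  Finsupp.lhom_ext h

/-- Passage from scalars to operators: all four products share the same normally ordered product, so
a relation between commutators with factor `x z/w` may be tested on `commFactor`. Taking `x = 0`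
gives vanishing. -/
theorem qcomm_eq_smul_qcomm [CharZero K] (hVW : HasContr p V W c 0 κ) (hWV : HasContr p W V c' 0 κ')
    {v v' x : K} (h : ∀ m, commFactor v c c' κ κ' m = x * commFactor v' c c' κ κ' (m + 1))
    (r s : ℚ) :
    qcomm v (V.series p) (W.series p) r s =
      x • qcomm v' (V.series p) (W.series p) (r - 1) (s + 1) := by
  refine end_ext fun w f => ?_
  rw [LinearMap.smul_apply]
  by_cases hint : (∃ d : ℤ, (d : ℚ) = r - V.pow w) ∧ ∃ e : ℤ, (e : ℚ) = s - W.pow w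
  · obtain ⟨⟨d, hd⟩, e, he⟩ := hint
    rw [qcomm_single_of_int hVW hWV v hd he,
      qcomm_single_of_int hVW hWV v' (d := d - 1) (e := e + 1) (by push_cast; rw [hd]; ring)
        (by push_cast; rw [he]; ring), Finsupp.smul_single, normalSum_shift, smul_comm]
    have h1 := normalSum_smul_sub_smul p V W x 0 (fun m => commFactor v' c c' κ κ' (m + 1))
      (fun m => commFactor v' c c' κ κ' (m + 1)) d e f
    rw [zero_smul, sub_zero] at h1
    rw [h1]
    congr 3
    funext m
    rw [h m, zero_mul, sub_zero]
  · rw [qcomm_single_of_not_int hVW hWV v hint, qcomm_single_of_not_int hVW hWV v', smul_zero]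
    rintro ⟨⟨d, hd⟩, e, he⟩
    exact hint ⟨⟨d + 1, by push_cast; rw [hd]; ring⟩, e - 1, by push_cast; rw [he]; ring⟩

theorem expZ_zero_fun [CharZero K] {c : ℕ+ → K} (hc : ∀ k, c k = 0) (m : ℤ) :
    expZ K c m = if m = 0 then 1 else 0 := by
  rcases lt_or_ge m 0 with hm | hm
  · rw [expZ_of_neg _ hm, if_neg hm.ne]
  · lift m to ℕ using hm
    rw [expZ_natCast, expCoeff_log_ratio (a := 0) (b := 0) (by simpa using hc)]
    simp

/-- Exponentials without contractions commute. -/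
theorem qcomm_one_eq_zero [CharZero K] (hVW : HasContr p V W (fun _ => 0) 0 1)
    (hWV : HasContr p W V (fun _ => 0) 0 1) : qcomm 1 (V.series p) (W.series p) = 0 := by
  funext r s
  rw [qcomm_eq_smul_qcomm hVW hWV (v' := 1) (x := 0), zero_smul]
  · rfl
  · intro m
    simp [commFactor, expZ_zero_fun]

/-- Two commutators which are opposite multiples of the delta function at `w = u z` cancel if the
normally ordered products agree there. -/
theorem qcomm_add_qcomm_eq_zero [CharZero K] {V' W' : NExp n K} {c₁ c₁' : ℕ+ → K} {κ₁ κ₁' : K}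
    (hVW : HasContr p V W c 0 κ) (hWV : HasContr p W V c' 0 κ')
    (hVW' : HasContr p V' W' c₁ 0 κ₁) (hWV' : HasContr p W' V' c₁' 0 κ₁') {u x : K} (hu : u ≠ 0)
    (h : ∀ m, commFactor 1 c c' κ κ' m = x * u⁻¹ ^ m)
    (h' : ∀ m, commFactor 1 c₁ c₁' κ₁ κ₁' m = -x * u⁻¹ ^ m) (hV : V.pow = V'.pow)
    (hW : W.pow = W'.pow) (hn : V * W.dilate u = V' * W'.dilate u) (r s : ℚ) :
    qcomm 1 (V.series p) (W.series p) r s + qcomm 1 (V'.series p) (W'.series p) r s = 0 := by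
  refine end_ext fun w f => ?_
  rw [LinearMap.add_apply, LinearMap.zero_apply]
  by_cases hint : (∃ d : ℤ, (d : ℚ) = r - V.pow w) ∧ ∃ e : ℤ, (e : ℚ) = s - W.pow w
  · obtain ⟨⟨d, hd⟩, e, he⟩ := hint
    have key : ∀ (V W : NExp n K) (y : K), normalSum p V W (fun m => y * u⁻¹ ^ m) d e f =
        y • u⁻¹ ^ e • (V * W.dilate u).osc p (d + e : ℤ) f := by
      intro V W y
      have h1 := normalSum_smul_sub_smul p V W y 0 (fun m => u⁻¹ ^ m) (fun m => u⁻¹ ^ m) d e f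
      rw [zero_smul, sub_zero, normalSum_delta p hu] at h1
      rw [h1]
      congr 1
      funext m
      rw [zero_mul, sub_zero]
    have hs : V.scal w * W.scal w = V'.scal w * W'.scal w :=
      congrFun (congrArg NExp.scal hn) w
    have hA : V.shA + W.shA = V'.shA + W'.shA := congrArg NExp.shA hn
    have hB : V.shB + W.shB = V'.shB + W'.shB := congrArg NExp.shB hn
    rw [qcomm_single_of_int hVW hWV 1 hd he,
      qcomm_single_of_int hVW' hWV' 1 (hV ▸ hd) (hW ▸ he), funext h, funext h', key, key, hn, hs,
      hA, hB, ← Finsupp.single_add, ← smul_add, ← add_smul, add_neg_cancel, zero_smul, smul_zero,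
      Finsupp.single_zero]
  · rw [qcomm_single_of_not_int hVW hWV 1 hint,
      qcomm_single_of_not_int hVW' hWV' 1 (by rwa [← hV, ← hW]), add_zero]

end NExp

/-! ### Bilinearity of the `v`-commutator. -/

section Bilinear

variable {n : ℕ} {K : Type*} [Field K]

theorem mul_smul_sub_comm {R : Type*} [Ring R] [Algebra K R] (v x : K) (a b b' : R) :
    a * (x • (b - b')) - v • (x • (b - b') * a) =
      x • ((a * b - v • (b * a)) - (a * b' - v • (b' * a))) := by
  simp only [smul_mul_assoc, mul_smul_comm, mul_sub, sub_mul, smul_sub, smul_comm v x]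
  abel

theorem smul_sub_mul_comm {R : Type*} [Ring R] [Algebra K R] (v x : K) (a a' b : R) :
    x • (a - a') * b - v • (b * (x • (a - a'))) =
      x • ((a * b - v • (b * a)) - (a' * b - v • (b * a'))) := by
  simp only [smul_mul_assoc, mul_smul_comm, mul_sub, sub_mul, smul_sub, smul_comm v x]
  abel

theorem smul_mul_comm {R : Type*} [Ring R] [Algebra K R] (v x : K) (a b : R) :
    x • a * b - v • (b * (x • a)) = x • (a * b - v • (b * a)) := by
  simp only [smul_mul_assoc, mul_smul_comm, smul_sub, smul_comm v x]

theorem mul_smul_comm_sub {R : Type*} [Ring R] [Algebra K R] (v x : K) (a b : R) :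
    a * (x • b) - v • (x • b * a) = x • (a * b - v • (b * a)) := by
  simp only [smul_mul_assoc, mul_smul_comm, smul_sub, smul_comm v x]

theorem qcomm_smul_left (v x : K) (A B : Series n K) (r s : ℚ) :
    qcomm v (x • A) B r s = x • qcomm v A B r s :=
  smul_mul_comm v x (A r) (B s)

theorem qcomm_smul_right (v x : K) (A B : Series n K) (r s : ℚ) :
    qcomm v A (x • B) r s = x • qcomm v A B r s :=
  mul_smul_comm_sub v x (A r) (B s)

theorem qcomm_sub_right (v : K) (A B B' : Series n K) (r s : ℚ) :
    qcomm v A (B - B') r s = qcomm v A B r s - qcomm v A B' r s := by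
  have h := mul_smul_sub_comm v 1 (A r) (B s) (B' s)
  simp only [one_smul] at h
  exact h

theorem qcomm_qdiff_left (p v : K) (G : ℚ → Series n K) (B : Series n K) (y r s : ℚ) :
    qcomm v (qdiff p G y) B r s = ((qpow p (1 / 2) - qpow p (-1 / 2)) * qpow p y)⁻¹ •
      (qcomm v (G (y + 1 / 2)) B (r + 1) s - qcomm v (G (y - 1 / 2)) B (r + 1) s) :=
  smul_sub_mul_comm v _ (G (y + 1 / 2) (r + 1)) (G (y - 1 / 2) (r + 1)) (B s)

theorem qcomm_qdiff_right (p v : K) (A : Series n K) (G : ℚ → Series n K) (y r s : ℚ) :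
    qcomm v A (qdiff p G y) r s = ((qpow p (1 / 2) - qpow p (-1 / 2)) * qpow p y)⁻¹ •
      (qcomm v A (G (y + 1 / 2)) r (s + 1) - qcomm v A (G (y - 1 / 2)) r (s + 1)) :=
  mul_smul_sub_comm v _ (A r) (G (y + 1 / 2) (s + 1)) (G (y - 1 / 2) (s + 1))

end Bilinear

/-! ### Powers of `q` and `q`-numbers. -/

section Powers

variable {K : Type*} [Field K] {p : K}

theorem qpow_eq {x : ℚ} {m : ℤ} (h : 4 * x = m) : qpow p x = p ^ m := by
  rw [qpow, h, Int.floor_intCast]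

/-- `qpow` rounds its exponent down to `¼ ℤ`, so additivity needs a quarter-integrality hypothesis;
one argument is enough, since the floor commutes with adding an integer. -/
theorem qpow_add (hp0 : p ≠ 0) {x : ℚ} (hx : ∃ m : ℤ, 4 * x = m) (y : ℚ) :
    qpow p (x + y) = qpow p x * qpow p y := by
  obtain ⟨m, hm⟩ := hx
  rw [qpow_eq hm, qpow, qpow, mul_add, hm, Int.floor_intCast_add, zpow_add₀ hp0]

theorem qpow_mul_natCast {x : ℚ} (hx : ∃ m : ℤ, 4 * x = m) (k : ℕ) :
    qpow p (x * k) = qpow p x ^ k := by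
  obtain ⟨m, hm⟩ := hx
  rw [qpow_eq hm, qpow_eq (m := m * k) (by push_cast; rw [← hm]; ring), zpow_mul, zpow_natCast]

theorem qpow_neg {x : ℚ} (hx : ∃ m : ℤ, 4 * x = m) : qpow p (-x) = (qpow p x)⁻¹ := by
  obtain ⟨m, hm⟩ := hx
  rw [qpow_eq hm, qpow_eq (m := -m) (by push_cast; rw [← hm]; ring), zpow_neg]

theorem qpow_zero : qpow p 0 = 1 := by simp [qpow]

theorem qpow_ne_zero (hp0 : p ≠ 0) (x : ℚ) : qpow p x ≠ 0 := zpow_ne_zero _ hp0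

theorem zpow_ne_one (hp : ∀ k : ℕ, 0 < k → p ^ k ≠ 1) {m : ℤ} (hm : m ≠ 0) : p ^ m ≠ 1 := by
  intro h
  refine hp m.natAbs (by omega) ?_
  rcases Int.natAbs_eq m with h1 | h1
  · rw [h1, zpow_natCast] at h
    exact h
  · rw [h1, zpow_neg, zpow_natCast, inv_eq_one] at h
    exact h

/-- `[N k / 2]` in terms of `X = q ^ (k / 2)`. -/
theorem qnum_eq (N : ℤ) (k : ℕ) {x : ℚ} (hx : x = N * k / 2) :
    qnum p x = ((p ^ (2 * k)) ^ N - (p ^ (2 * k)) ^ (-N)) / (qpow p 1 - qpow p (-1)) := by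
  subst hx
  have h : ∀ N : ℤ, qpow p ((N : ℚ) * k / 2) = (p ^ (2 * k)) ^ N := by
    intro N
    rw [qpow_eq (m := (2 * k : ℕ) * N) (by push_cast; ring), zpow_mul, zpow_natCast]
  rw [qnum, h, show -((N : ℚ) * k / 2) = ((-N : ℤ) : ℚ) * k / 2 by push_cast; ring, h]

theorem qnum_ne_zero (hp0 : p ≠ 0) (hp : ∀ k : ℕ, 0 < k → p ^ k ≠ 1) {m : ℤ} (hm : m ≠ 0)
    {x : ℚ} (hx : 4 * x = m) : qnum p x ≠ 0 := by
  have h : ∀ {m : ℤ} {x : ℚ}, m ≠ 0 → 4 * x = m → qpow p x - qpow p (-x) ≠ 0 := by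
    intro m x hm hx h0
    rw [qpow_neg ⟨m, hx⟩, qpow_eq hx, sub_eq_zero, ← zpow_neg] at h0
    refine zpow_ne_one hp (m := m + m) (by omega) ?_
    rw [zpow_add₀ hp0]
    nth_rw 1 [h0]
    rw [← zpow_add₀ hp0, neg_add_cancel, zpow_zero]
  exact div_ne_zero (h hm hx) (h (m := 4) (by norm_num) (by norm_num))

theorem qnum_zero : qnum p 0 = 0 := by simp [qnum]

theorem qnum_neg (x : ℚ) : qnum p (-x) = -qnum p x := by
  rw [qnum, qnum, neg_neg, ← neg_div, neg_sub]

end Powers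

/-! ### The bilinear form and the symmetrized Cartan matrix of type `C_n`. -/

section Form

variable {n : ℕ}

theorem form_comm (x y : Fin n → ℚ) : form x y = form y x := by
  simp only [form, mul_comm]

theorem form_add (x y z : Fin n → ℚ) : form x (y + z) = form x y + form x z := by
  simp only [form, ← Finset.sum_add_distrib, Pi.add_apply]
  exact Finset.sum_congr rfl fun k _ => by ring

theorem form_toRat_sub (x : Fin n → ℚ) (y z : Fin n → ℤ) :
    form x (toRat (y - z)) = form x (toRat y) - form x (toRat z) := by
  simp only [form, ← Finset.sum_sub_distrib, toRat, Pi.sub_apply, Int.cast_sub]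
  exact Finset.sum_congr rfl fun k _ => by ring

theorem form_toRat_smul (x : Fin n → ℚ) (s : ℤ) (y : Fin n → ℤ) :
    form x (toRat (s • y)) = s * form x (toRat y) := by
  simp only [form, Finset.mul_sum, toRat, Pi.smul_apply, smul_eq_mul, Int.cast_mul]
  exact Finset.sum_congr rfl fun k _ => by ring

theorem form_toRat_zero (x : Fin n → ℚ) : form x (toRat 0) = 0 := by
  simp [form, toRat]

theorem form_eps (i j : ℕ) :
    form (toRat (eps n i)) (toRat (eps n j)) = if i = j ∧ 1 ≤ i ∧ i ≤ n then 1 / 2 else 0 := by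
  simp only [form, toRat, eps]
  by_cases h : i = j ∧ 1 ≤ i ∧ i ≤ n
  · obtain ⟨rfl, h1, h2⟩ := h
    rw [if_pos ⟨rfl, h1, h2⟩, Finset.sum_eq_single (⟨i - 1, by omega⟩ : Fin n)]
    · simp [Nat.sub_add_cancel h1]
    · intro b _ hb
      rw [if_neg]
      · simp
      · intro h
        exact hb (Fin.ext (by simp; omega))
    · simp
  · rw [if_neg h]
    refine Finset.sum_eq_zero fun k _ => ?_
    have hk := k.2
    split_ifs <;> first | omega | simp

theorem form_root (x : Fin n → ℚ) (j : ℕ) :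
    form x (toRat (root n j)) =
      if j < n then form x (toRat (eps n j)) - form x (toRat (eps n (j + 1)))
      else 2 * form x (toRat (eps n n)) := by
  unfold root
  split_ifs
  · exact form_toRat_sub _ _ _
  · rw [two_smul, ← sub_neg_eq_add, form_toRat_sub, ← neg_one_smul ℤ, form_toRat_smul]
    push_cast
    ring

theorem form_eps_one_root {i : ℕ} (hn : 2 ≤ n) (hi : 1 ≤ i) :
    form (toRat (eps n 1)) (toRat (root n i)) = if i = 1 then 1 / 2 else 0 := by
  simp only [form_root, form_eps]
  split_ifs <;> first | omega | norm_num

theorem form_root_root {i j : ℕ} (hi : 1 ≤ i) (hin : i ≤ n) (hj : 1 ≤ j) (hjn : j ≤ n) :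
    form (toRat (root n i)) (toRat (root n j)) =
      if i = j then (if i < n then 1 else 2) else
      if i + 1 = j then (if j < n then -1 / 2 else -1) else
      if j + 1 = i then (if i < n then -1 / 2 else -1) else 0 := by
  have h : ∀ k, form (toRat (root n i)) (toRat (eps n k)) =
      form (toRat (eps n k)) (toRat (root n i)) := fun k => form_comm _ _
  simp only [form_root, h, form_eps]
  split_ifs <;>
    first
    | omega
    | exact absurd ⟨trivial, by omega, le_rfl⟩ ‹¬(True ∧ 1 ≤ n ∧ n ≤ n)›
    | norm_num

theorem fundWt_one : fundWt n 1 = eps n 1 := by simp [fundWt]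

theorem Charge.shift_al (w : Charge n) (a b : Fin n → ℤ) :
    (w.shift a b).al = w.al + toRat a := by
  funext k
  simp [Charge.al, Charge.shift, toRat]
  ring

theorem Charge.shift_be (w : Charge n) (a b : Fin n → ℤ) :
    (w.shift a b).be = w.be + toRat b := by
  funext k
  simp [Charge.be, Charge.shift, toRat]

end Form

/-! ### Contractions of the elementary factors, and duality of `a_{\bar 1}` with `a_1`. -/

section

variable {n : ℕ} {K : Type*} [Field K] {p : K}

namespace NExp

theorem hasContr_Z_Z_of_ne (i j : ℕ) (hij : i ≠ j) (s t : ℤ) (y x : ℚ) :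
    HasContr p (Z p n i s y) (Z p n j t x) (fun _ => 0) 0 1 where
  contr_eq k := by
    have h : ∀ a : Fin n, ¬ ((a : ℕ) + 1 = i ∧ (a : ℕ) + 1 = j) := by
      rintro a ⟨h1, h2⟩
      exact hij (h1.symm.trans h2)
    have h' : ∀ a : Fin n, (Z p n i s y).annB k a * (Z p n j t x).creB k a = 0 := by
      intro a
      simp only [Z]
      split_ifs with h1 h2
      · exact absurd ⟨h1, h2⟩ (h a)
      all_goals simp
    simp only [contr, h']
    simp [Z]
  pow_shift w := by
    simp [Z, Charge.shift_be, form_add, form_toRat_smul, form_eps, hij, -zsmul_eq_mul]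
  scal_shift w := by
    simp [Z, Charge.shift_be, form_add, form_toRat_smul, form_eps, hij, -zsmul_eq_mul]

/-- Oscillators and zero modes together give the factor `(q^y z - q^x w)^{st}`, expanded in powers
of `w/z`. -/
theorem hasContr_Z_Z [CharZero K] (hp0 : p ≠ 0) (hn : 1 ≤ n) (s t : ℤ) {y x : ℚ}
    (hy : ∃ m : ℤ, 4 * y = m) (hx : ∃ m : ℤ, 4 * x = m) :
    HasContr p (Z p n 1 s y) (Z p n 1 t x)
      (fun k => -((s : K) * t * (qpow p x * (qpow p y)⁻¹) ^ (k : ℕ) / ((k : ℕ) : K))) (s * t)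
      (qpow p (y * (s * t))) where
  contr_eq k := by
    have hk : ((k : ℕ) : K) ≠ 0 := by exact_mod_cast k.ne_zero
    have h1 : ∀ a : Fin n, (Z p n 1 s y).annB k a * (Z p n 1 t x).creB k a * ((k : ℕ) : K) =
        if a = ⟨0, hn⟩ then
          -((s : K) * t * (qpow p x * (qpow p y)⁻¹) ^ (k : ℕ) / ((k : ℕ) : K)) else 0 := by
      intro a
      have ha : (a : ℕ) + 1 = 1 ↔ a = ⟨0, hn⟩ := by simp [Fin.ext_iff]
      simp only [Z, ha]
      split_ifs with h
      · obtain ⟨m, hm⟩ := hy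
        rw [qpow_neg ⟨m * k, by push_cast; rw [← hm]; ring⟩, qpow_mul_natCast ⟨m, hm⟩,
          qpow_mul_natCast hx, mul_pow, inv_pow]
        field_simp
      · simp
    simp only [contr, h1]
    simp [Z]
  pow_shift w := by
    simp [Z, Charge.shift_be, form_add, form_toRat_smul, form_eps, hn, -zsmul_eq_mul]
    ring
  scal_shift w := by
    obtain ⟨m, hm⟩ := hy
    change qpow p _ = _ * qpow p _
    rw [← qpow_add hp0 ⟨m * (s * t), by push_cast; rw [← hm]; ring⟩]
    simp [Z, Charge.shift_be, form_add, form_toRat_smul, form_eps, hn, -zsmul_eq_mul]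
    congr 1
    ring

theorem hasContr_phiA_Z (μ : Fin n → ℚ) (i : ℕ) (s : ℤ) (y : ℚ) :
    HasContr p (phiA p n μ) (Z p n i s y) (fun _ => 0) 0 1 where
  contr_eq k := by simp [contr, phiA, Z]
  pow_shift w := by simp [phiA, Z, Charge.shift_al, form_add, form_toRat_zero]
  scal_shift w := by simp [phiA, Z, Charge.shift_al, form_add, form_toRat_zero]

theorem hasContr_Z_phiA (μ : Fin n → ℚ) (i : ℕ) (s : ℤ) (y : ℚ) :
    HasContr p (Z p n i s y) (phiA p n μ) (fun _ => 0) 0 1 where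
  contr_eq k := by simp [contr, phiA, Z]
  pow_shift w := by simp [phiA, Z, Charge.shift_be, form_add, form_toRat_zero]
  scal_shift w := by simp [phiA, Z, Charge.shift_be, form_add, form_toRat_zero]

theorem hasContr_Y_Z (i j : ℕ) (s t : ℤ) (y : ℚ) :
    HasContr p (Y p n i s) (Z p n j t y) (fun _ => 0) 0 1 where
  contr_eq k := by simp [contr, Y, Z]
  pow_shift w := by simp [Y, Z, Charge.shift_al, form_add, form_toRat_zero]
  scal_shift w := by simp [Y]

theorem hasContr_Z_Y (i j : ℕ) (s t : ℤ) (y : ℚ) :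
    HasContr p (Z p n j t y) (Y p n i s) (fun _ => 0) 0 1 where
  contr_eq k := by simp [contr, Y, Z]
  pow_shift w := by simp [Y, Z, Charge.shift_be, form_add, form_toRat_zero]
  scal_shift w := by simp [Y, Z, Charge.shift_be, form_add, form_toRat_zero]

theorem aPair_comm (k : ℕ+) (i j : Fin n) : aPair p n k i j = aPair p n k j i := by
  rw [aPair, aPair, form_comm]

theorem abarCoeff_neg (m : ℤ) (j : Fin n) : abarCoeff p n (-m) j = -abarCoeff p n m j := by
  have h : ∀ x y : ℚ, qnum p (x * ((-m : ℤ) : ℚ)) / qnum p (y * ((-m : ℤ) : ℚ) / 2) =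
      qnum p (x * m) / qnum p (y * m / 2) := by
    intro x y
    rw [Int.cast_neg, mul_neg, mul_neg, neg_div, qnum_neg, qnum_neg, neg_div_neg_eq]
  have h' : ∀ x y : ℚ, qnum p (x * ((-m : ℤ) : ℚ) / 2) / qnum p (y * ((-m : ℤ) : ℚ)) =
      qnum p (x * m / 2) / qnum p (y * m) := by
    intro x y
    rw [Int.cast_neg, mul_neg, mul_neg, neg_div, qnum_neg, qnum_neg, neg_div_neg_eq]
  rw [abarCoeff, abarCoeff, h, h', Int.cast_neg, Int.cast_neg, neg_div (2 : ℚ), qnum_neg]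
  ring

/-- The Cartan matrix is tridiagonal, so the sums to be evaluated have at most three nonzero terms.
-/
theorem sum_fin_eq_of_near {M : Type*} [AddCommMonoid M] (T : Fin n → M) (j : Fin n)
    (hT : ∀ a : Fin n, a ≠ j → (a : ℕ) + 1 ≠ j → (j : ℕ) + 1 ≠ a → T a = 0) :
    ∑ a, T a = T j + ((if h : 0 < (j : ℕ) then T ⟨(j : ℕ) - 1, by omega⟩ else 0) +
      if h : (j : ℕ) + 1 < n then T ⟨(j : ℕ) + 1, h⟩ else 0) := by
  have h : ∀ a, T a = (if a = j then T a else 0) + ((if (a : ℕ) + 1 = j then T a else 0) +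
      if (j : ℕ) + 1 = a then T a else 0) := by
    intro a
    have h1 : a = j ↔ (a : ℕ) = j := Fin.ext_iff
    by_cases ha : (a : ℕ) = j ∨ (a : ℕ) + 1 = j ∨ (j : ℕ) + 1 = a
    · rcases ha with ha | ha | ha
      · simp [h1, ha]
      · rw [if_neg (by omega), if_pos ha, if_neg (by omega)]; simp
      · rw [if_neg (by omega), if_neg (by omega), if_pos ha]; simp
    · push Not at ha
      rw [if_neg (by omega), if_neg ha.2.1, if_neg ha.2.2,
        hT a (by omega) ha.2.1 ha.2.2]
      simp
  rw [Finset.sum_congr rfl fun a _ => h a, Finset.sum_add_distrib, Finset.sum_add_distrib]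
  congr 1
  · simp
  congr 1
  · split_ifs with h0
    · rw [Finset.sum_eq_single (⟨(j : ℕ) - 1, by omega⟩ : Fin n), if_pos (by simp; omega)]
      · intro b _ hb
        rw [if_neg]
        intro h
        exact hb (Fin.ext (by simp; omega))
      · simp
    · exact Finset.sum_eq_zero fun a _ => if_neg (by omega)
  · split_ifs with h0
    · rw [Finset.sum_eq_single (⟨(j : ℕ) + 1, h0⟩ : Fin n), if_pos rfl]
      · intro b _ hb
        rw [if_neg]
        intro h
        exact hb (Fin.ext (by simp; omega))
      · simp
    · exact Finset.sum_eq_zero fun a _ => if_neg (by omega)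

/-- `X ^ N + X ^ (-N)` for `X = q ^ (k / 2)`. -/
def hsum (p : K) (k : ℕ) (N : ℤ) : K := (p ^ (2 * k)) ^ N + (p ^ (2 * k)) ^ (-N)

theorem hsum_mul_hsum (hp0 : p ≠ 0) (k : ℕ) (M N : ℤ) :
    hsum p k M * hsum p k N = hsum p k (N + M) + hsum p k (N - M) := by
  have h : p ^ (2 * k) ≠ 0 := pow_ne_zero _ hp0
  simp only [hsum, neg_add, neg_sub, zpow_add₀ h, zpow_sub₀ h, zpow_neg]
  field_simp
  ring

theorem qnum_double (hp0 : p ≠ 0) (N : ℤ) (k : ℕ) {x y : ℚ} (hx : x = N * k)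
    (hy : y = N * k / 2) : qnum p x = qnum p y * hsum p k N := by
  have h : p ^ (2 * k) ≠ 0 := pow_ne_zero _ hp0
  rw [qnum_eq (2 * N) k (by rw [hx]; push_cast; ring), qnum_eq N k hy, hsum, div_mul_eq_mul_div,
    show 2 * N = N + N by ring, neg_add, zpow_add₀ h, zpow_add₀ h]
  congr 1
  ring

/-- Write `H(N)` for `hsum p k N`, `b = [k/2]`, so `[Nk] = [Nk/2] H(N)`. Up to a common factor
`a_{\bar 1}` has entries `H(n - j)`, `j` counted from zero, with last entry `1`, and `H(1)H(N) =
H(N+1) + H(N-1)` is the three-term recursion of the Cartan matrix. Rows with both neighbours cancel;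
the first row lacks its left neighbour and leaves `b H(n+1)`, which the normalization removes. -/
theorem sum_abarCoeff_mul_aPair [CharZero K] (hp0 : p ≠ 0) (hp : ∀ k : ℕ, 0 < k → p ^ k ≠ 1)
    (hn : 2 ≤ n) (k : ℕ+) (j : Fin n) :
    ∑ a, abarCoeff p n (k : ℕ) a * aPair p n k a j = if (j : ℕ) = 0 then -1 else 0 := by
  have hk : ((k : ℕ) : K) ≠ 0 := by exact_mod_cast k.ne_zero
  have hkn : (k : ℕ) ≠ 0 := k.ne_zero
  set b := qnum p (((k : ℕ) : ℚ) / 2) with hbdef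
  have hq : ∀ N : ℤ, N ≠ 0 → ∀ x : ℚ, x = N * (k : ℕ) / 2 → qnum p x ≠ 0 := by
    intro N hN x hx
    refine qnum_ne_zero hp0 hp (m := 2 * (N * (k : ℕ))) ?_ (by rw [hx]; push_cast; ring)
    simp [hN]
  have hb : b ≠ 0 := hq 1 one_ne_zero _ (by push_cast; ring)
  have hd1 : qnum p ((k : ℕ) * 1) = b * hsum p k 1 :=
    qnum_double hp0 1 k (by push_cast; ring) (by push_cast; ring)
  have hd2 : qnum p ((k : ℕ) * 2) = b * hsum p k 1 * hsum p k 2 := by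
    rw [← hd1]
    exact qnum_double hp0 2 k (by push_cast; ring) (by push_cast; ring)
  have hratio : ∀ N : ℤ, N ≠ 0 → ∀ x : ℚ, x = N → qnum p (x * ((k : ℕ) : ℤ)) /
      qnum p (x * ((k : ℕ) : ℤ) / 2) = hsum p k N := by
    rintro N hN x rfl
    rw [qnum_double hp0 N k (x := (N : ℚ) * ((k : ℕ) : ℤ)) (y := (N : ℚ) * ((k : ℕ) : ℤ) / 2)
      (by push_cast; ring) (by push_cast; ring), mul_div_cancel_left₀]
    exact hq N hN _ (by push_cast; ring)
  -- `H(n+1)` is a quotient of `q`-numbers with nonzero argument, hence nonzero as `q` is not a root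
  -- of unity.
  have hH : hsum p k (n + 1) ≠ 0 := by
    rw [← hratio (n + 1) (by omega) (n + 1) (by push_cast; ring)]
    exact div_ne_zero (hq (2 * (n + 1)) (by omega) _ (by push_cast; ring))
      (hq (n + 1) (by omega) _ (by push_cast; ring))
  have hR : qnum p (((n : ℚ) + 1) * ((k : ℕ) : ℤ) / 2) / qnum p (((n : ℚ) + 1) * ((k : ℕ) : ℤ)) =
      (hsum p k (n + 1))⁻¹ := by
    rw [← hratio (n + 1) (by omega) (n + 1) (by push_cast; ring), inv_div]
  set g : Fin n → K := fun a => if (a : ℕ) + 1 < n then hsum p k (n - (a : ℕ)) else 1 with hg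
  set B : Fin n → K := fun a => qnum p ((k : ℕ) * form (toRat (root n ((a : ℕ) + 1)))
    (toRat (root n ((j : ℕ) + 1)))) with hB
  have hterm : ∀ a, abarCoeff p n (k : ℕ) a * aPair p n k a j =
      -(b * hsum p k (n + 1))⁻¹ * (g a * B a) := by
    intro a
    have h1 : (if (a : ℕ) + 1 < n then qnum p (((n : ℚ) - (a : ℕ)) * ((k : ℕ) : ℤ)) /
        qnum p (((n : ℚ) - (a : ℕ)) * ((k : ℕ) : ℤ) / 2) else 1) = g a := by
      simp only [hg]
      split_ifs
      · exact hratio (n - (a : ℕ)) (by omega) _ (by push_cast; ring)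
      · rfl
    rw [abarCoeff, h1, hR, aPair, neg_div, qnum_neg]
    simp only [hB, Int.cast_natCast, ← hbdef]
    field_simp
  have hBv := fun a : Fin n => form_root_root (n := n) (i := (a : ℕ) + 1) (j := (j : ℕ) + 1)
    (by omega) (by omega) (by omega) (by omega)
  have hneg1 : qnum p ((k : ℕ) * (-1)) = -(b * hsum p k 1) := by
    rw [mul_neg, qnum_neg, hd1]
  have hneg2 : qnum p ((k : ℕ) * (-1 / 2)) = -b := by
    rw [show ((k : ℕ) : ℚ) * (-1 / 2) = -(((k : ℕ) : ℚ) / 2) by ring, qnum_neg]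
  rw [Finset.sum_congr rfl fun a _ => hterm a, ← Finset.mul_sum, sum_fin_eq_of_near _ j]
  · have hj := j.2
    have e1 : ∀ M N : ℤ, M = N → hsum p k M = hsum p k N := fun M N h => by rw [h]
    have hmul := fun N : ℤ => hsum_mul_hsum hp0 (k : ℕ) 1 N
    by_cases hlast : (j : ℕ) + 1 < n
    · have tj : g j * B j = b * (hsum p k (n - (j : ℕ) + 1) + hsum p k (n - (j : ℕ) - 1)) := by
        simp only [hg, hB, hBv, if_true, if_pos hlast, hd1]
        rw [← hmul]
        ring
      have tnext : g ⟨(j : ℕ) + 1, hlast⟩ * B ⟨(j : ℕ) + 1, hlast⟩ =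
          -(b * hsum p k (n - (j : ℕ) - 1)) := by
        simp only [hg, hB, hBv]
        by_cases h : (j : ℕ) + 1 + 1 < n
        · simp only [if_pos h]
          rw [if_neg (by omega), if_neg (by omega), if_true, hneg2,
            e1 (n - ((j : ℕ) + 1 : ℕ)) (n - (j : ℕ) - 1) (by push_cast; ring)]
          ring
        -- The right neighbour is the long root: its entry is `1` rather than `H(1)`, but the
        -- pairing is `-[k] = -b H(1)`, so the product still fits the recursion.
        · simp only [if_neg h]
          rw [if_neg (by omega), if_neg (by omega), if_true, hneg1,
            e1 (n - (j : ℕ) - 1) 1 (by omega)]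
          ring
      rw [tj, dif_pos hlast, tnext]
      split_ifs with h0 h1 h1
      · omega
      · have tprev : g ⟨(j : ℕ) - 1, by omega⟩ * B ⟨(j : ℕ) - 1, by omega⟩ =
            -(b * hsum p k (n - (j : ℕ) + 1)) := by
          simp only [hg, hB, hBv]
          rw [if_pos (by omega), if_neg (by omega), if_pos (by omega), if_pos (by omega), hneg2,
            e1 (n - ((j : ℕ) - 1 : ℕ)) (n - (j : ℕ) + 1) (by omega)]
          ring
        rw [tprev]
        ring
      · rw [h1, e1 (n - (0 : ℕ) + 1) (n + 1) (by simp)]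
        field_simp
        ring
      · omega
    -- Last row: `[2k]` cancels against `H(2) [k]`; since `n ≥ 2`, this row is not the first one.
    · have tj : g j * B j = b * hsum p k 1 * hsum p k 2 := by
        simp only [hg, hB, hBv, if_true, if_neg hlast, hd2, one_mul]
      have tprev : g ⟨(j : ℕ) - 1, by omega⟩ * B ⟨(j : ℕ) - 1, by omega⟩ =
          -(b * hsum p k 1 * hsum p k 2) := by
        simp only [hg, hB, hBv]
        rw [if_pos (by omega), if_neg (by omega), if_pos (by omega), if_neg (by omega), hneg1,
          e1 (n - ((j : ℕ) - 1 : ℕ)) 2 (by omega)]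
        ring
      rw [tj, dif_neg hlast, dif_pos (by omega), tprev, if_neg (by omega)]
      ring
  · intro a h1 h2 h3
    have h4 : (a : ℕ) ≠ j := fun h => h1 (Fin.ext h)
    simp only [hB, hBv]
    rw [if_neg (by omega), if_neg (by omega), if_neg (by omega), mul_zero, qnum_zero, mul_zero]

end NExp

end

/-! ### Contractions of the vertex operator with the factors of the currents. -/

namespace NExp

variable {n : ℕ} {K : Type*} [Field K] {p : K}

theorem form_fundWt_one_root (hn : 2 ≤ n) {i : ℕ} (hi : 1 ≤ i) (s : ℤ) :
    form (toRat (fundWt n 1)) (toRat (s • root n i)) = if i = 1 then (s : ℚ) / 2 else 0 := by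
  rw [form_toRat_smul, fundWt_one, form_eps_one_root hn hi]
  split_ifs <;> ring

theorem sum_Y_coeff {i : ℕ} (hi : 1 ≤ i) (hin : i ≤ n) (F : Fin n → K) (y : K) :
    ∑ b : Fin n, (if (b : ℕ) + 1 = i then y else 0) * F b = y * F ⟨i - 1, by omega⟩ := by
  rw [Finset.sum_eq_single (⟨i - 1, by omega⟩ : Fin n), if_pos (by simp; omega)]
  · intro b _ hb
    rw [if_neg, zero_mul]
    intro h
    exact hb (Fin.ext (by simp; omega))
  · simp

/-- The sign `-1` from the duality with `a_1` cancels the one in `[-k/2] = -[k/2]`. The constant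
comes from `(q^{n+1/2} z)^{-λ_1(0)}` crossing `e^{±α_1}`. -/
theorem hasContr_phiA_Y [CharZero K] (hp0 : p ≠ 0) (hp : ∀ k : ℕ, 0 < k → p ^ k ≠ 1) (hn : 2 ≤ n)
    (μ : Fin n → ℚ) {i : ℕ} (hi : 1 ≤ i) (hin : i ≤ n) (s : ℤ) :
    HasContr p (phiA p n μ) (Y p n i s)
      (fun k => if i = 1 then (s : K) * qpow p (-(n + 3 / 4) + s / 4) ^ (k : ℕ) / ((k : ℕ) : K)
        else 0)
      (if i = 1 then -s else 0) (if i = 1 then qpow p ((n + 1 / 2) * -s) else 1) where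
  contr_eq k := by
    have hk : ((k : ℕ) : K) ≠ 0 := by exact_mod_cast k.ne_zero
    have hb : qnum p (((k : ℕ) : ℚ) / 2) ≠ 0 :=
      qnum_ne_zero hp0 hp (m := 2 * (k : ℕ)) (by simp) (by push_cast; ring)
    have h1 : ∀ a : Fin n, ∑ b, (phiA p n μ).annA k a * (Y p n i s).creA k b * aPair p n k a b =
        qnum p (((k : ℕ) : ℚ) / 2) / ((k : ℕ) : K) * qpow p (-(((n : ℚ) + 3 / 4) * (k : ℕ))) *
        (s * (qpow p ((s : ℚ) * (k : ℕ) / 4) / qnum p (-((k : ℕ) : ℚ) / 2))) *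
        (abarCoeff p n (k : ℕ) a * aPair p n k a ⟨i - 1, by omega⟩) := by
      intro a
      have h2 := sum_Y_coeff hi hin (fun b => (phiA p n μ).annA k a * aPair p n k a b)
        (s * (qpow p ((s : ℚ) * (k : ℕ) / 4) / qnum p (-((k : ℕ) : ℚ) / 2)))
      rw [show ∑ b, (phiA p n μ).annA k a * (Y p n i s).creA k b * aPair p n k a b = _ from
        (Finset.sum_congr rfl fun b _ => by simp only [Y]; ring).trans h2]
      simp only [phiA]
      ring
    have h3 : ∑ b, (phiA p n μ).annB k b * (Y p n i s).creB k b * ((k : ℕ) : K) = 0 := by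
      simp [phiA]
    rw [contr, h3, add_zero, Finset.sum_congr rfl fun a _ => h1 a, ← Finset.mul_sum,
      sum_abarCoeff_mul_aPair hp0 hp hn]
    have h4 : (((⟨i - 1, by omega⟩ : Fin n) : ℕ) = 0) ↔ i = 1 := by simp; omega
    simp only [h4]
    split_ifs
    · have e : qpow p (-(n + 3 / 4) + s / 4) ^ (k : ℕ) =
          qpow p (-(((n : ℚ) + 3 / 4) * (k : ℕ))) * qpow p ((s : ℚ) * (k : ℕ) / 4) := by
        rw [← qpow_mul_natCast ⟨-(4 * n + 3) + s, by push_cast; ring⟩,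
          ← qpow_add hp0 ⟨-((4 * n + 3) * (k : ℕ)), by push_cast; ring⟩]
        congr 1
        ring
      rw [e, neg_div, qnum_neg]
      field_simp
    · simp
  pow_shift w := by
    simp only [phiA, Y, Charge.shift_al, form_add, form_fundWt_one_root hn hi]
    split_ifs <;> ring
  scal_shift w := by
    simp only [phiA, Y, Charge.shift_al, form_add, form_fundWt_one_root hn hi]
    split_ifs
    · rw [← qpow_add hp0 ⟨(4 * n + 2) * -s, by push_cast; ring⟩]
      congr 1
      ring
    · rw [add_zero, one_mul]

theorem hasContr_Y_phiA [CharZero K] (hp0 : p ≠ 0) (hp : ∀ k : ℕ, 0 < k → p ^ k ≠ 1) (hn : 2 ≤ n)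
    (μ : Fin n → ℚ) {i : ℕ} (hi : 1 ≤ i) (hin : i ≤ n) (s : ℤ) :
    HasContr p (Y p n i s) (phiA p n μ)
      (fun k => if i = 1 then (s : K) * qpow p (n + 1 / 4 + s / 4) ^ (k : ℕ) / ((k : ℕ) : K) else 0)
      (if i = 1 then -s else 0) 1 where
  contr_eq k := by
    have hk : ((k : ℕ) : K) ≠ 0 := by exact_mod_cast k.ne_zero
    have hb : qnum p (((k : ℕ) : ℚ) / 2) ≠ 0 :=
      qnum_ne_zero hp0 hp (m := 2 * (k : ℕ)) (by simp) (by push_cast; ring)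
    have h1 : ∀ b : Fin n, ∑ a, (Y p n i s).annA k a * (phiA p n μ).creA k b * aPair p n k a b =
        qnum p (((k : ℕ) : ℚ) / 2) / ((k : ℕ) : K) * qpow p (((n : ℚ) + 1 / 4) * (k : ℕ)) *
        (s * (qpow p ((s : ℚ) * (k : ℕ) / 4) / qnum p (-((k : ℕ) : ℚ) / 2))) *
        (abarCoeff p n (k : ℕ) b * aPair p n k b ⟨i - 1, by omega⟩) := by
      intro b
      have h2 := sum_Y_coeff hi hin (fun a => (phiA p n μ).creA k b * aPair p n k a b)
        (-s * (qpow p ((s : ℚ) * (k : ℕ) / 4) / qnum p (-((k : ℕ) : ℚ) / 2)))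
      rw [show ∑ a, (Y p n i s).annA k a * (phiA p n μ).creA k b * aPair p n k a b = _ from
        (Finset.sum_congr rfl fun a _ => by simp only [Y]; ring).trans h2]
      simp only [phiA]
      rw [abarCoeff_neg, aPair_comm k b]
      ring
    have h3 : ∑ b, (Y p n i s).annB k b * (phiA p n μ).creB k b * ((k : ℕ) : K) = 0 := by
      simp [phiA]
    rw [contr, h3, add_zero, Finset.sum_comm, Finset.sum_congr rfl fun a _ => h1 a,
      ← Finset.mul_sum, sum_abarCoeff_mul_aPair hp0 hp hn]
    have h4 : (((⟨i - 1, by omega⟩ : Fin n) : ℕ) = 0) ↔ i = 1 := by simp; omega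
    simp only [h4]
    split_ifs
    · have e : qpow p (n + 1 / 4 + s / 4) ^ (k : ℕ) =
          qpow p (((n : ℚ) + 1 / 4) * (k : ℕ)) * qpow p ((s : ℚ) * (k : ℕ) / 4) := by
        rw [← qpow_mul_natCast ⟨4 * n + 1 + s, by push_cast; ring⟩,
          ← qpow_add hp0 ⟨(4 * n + 1) * (k : ℕ), by push_cast; ring⟩]
        congr 1
        ring
      rw [e, neg_div, qnum_neg]
      field_simp
    · simp
  pow_shift w := by
    simp only [Y, phiA, Charge.shift_al, form_add]
    rw [form_comm (toRat (root n i)) (toRat (fundWt n 1)), fundWt_one, form_eps_one_root hn hi]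
    split_ifs <;> ring
  scal_shift w := by simp [Y]

/-- The factor `φ(z) Z_1^+(q^{n + 1/2 + y} z)` of the vertex operator. -/
def phiZ (p : K) (n : ℕ) (μ : Fin n → ℚ) (y : ℚ) : NExp n K :=
  phiA p n μ * Z p n 1 1 ((n : ℚ) + 1 / 2 + y)

theorem hasContr_phiZ_Z {i : ℕ} (hi : 1 ≠ i) (μ : Fin n → ℚ) (y : ℚ) (s : ℤ) (x : ℚ) :
    HasContr p (phiZ p n μ y) (Z p n i s x) (fun _ => 0) 0 1 :=
  ((hasContr_phiA_Z μ i s x).mul_left (hasContr_Z_Z_of_ne 1 i hi _ _ _ _)).congr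
    (fun _ => add_zero _) (add_zero _) (mul_one _)

theorem hasContr_Z_phiZ {i : ℕ} (hi : i ≠ 1) (μ : Fin n → ℚ) (y : ℚ) (s : ℤ) (x : ℚ) :
    HasContr p (Z p n i s x) (phiZ p n μ y) (fun _ => 0) 0 1 :=
  ((hasContr_Z_phiA μ i s x).mul_right (hasContr_Z_Z_of_ne i 1 hi _ _ _ _)).congr
    (fun _ => add_zero _) (add_zero _) (mul_one _)

theorem hasContr_phiZ_Y [CharZero K] (hp0 : p ≠ 0) (hp : ∀ k : ℕ, 0 < k → p ^ k ≠ 1) (hn : 2 ≤ n)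
    {i : ℕ} (hi : 2 ≤ i) (hin : i ≤ n) (μ : Fin n → ℚ) (y : ℚ) (s : ℤ) :
    HasContr p (phiZ p n μ y) (Y p n i s) (fun _ => 0) 0 1 :=
  ((hasContr_phiA_Y hp0 hp hn μ (by omega) hin s).mul_left (hasContr_Z_Y i 1 s 1 _)).congr
    (fun _ => by rw [if_neg (by omega), add_zero]) (by rw [if_neg (by omega), add_zero])
    (by rw [if_neg (by omega), mul_one])

theorem hasContr_Y_phiZ [CharZero K] (hp0 : p ≠ 0) (hp : ∀ k : ℕ, 0 < k → p ^ k ≠ 1) (hn : 2 ≤ n)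
    {i : ℕ} (hi : 2 ≤ i) (hin : i ≤ n) (μ : Fin n → ℚ) (y : ℚ) (s : ℤ) :
    HasContr p (Y p n i s) (phiZ p n μ y) (fun _ => 0) 0 1 :=
  ((hasContr_Y_phiA hp0 hp hn μ (by omega) hin s).mul_right (hasContr_Y_Z i 1 s 1 _)).congr
    (fun _ => by rw [if_neg (by omega), add_zero]) (by rw [if_neg (by omega), add_zero])
    (mul_one _)

theorem HasContr.trivial_mul_left {V V' W : NExp n K} (h : HasContr p V W (fun _ => 0) 0 1)
    (h' : HasContr p V' W (fun _ => 0) 0 1) : HasContr p (V * V') W (fun _ => 0) 0 1 :=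
  (h.mul_left h').congr (fun _ => add_zero _) (add_zero _) (mul_one _)

theorem HasContr.trivial_mul_right {V W W' : NExp n K} (h : HasContr p V W (fun _ => 0) 0 1)
    (h' : HasContr p V W' (fun _ => 0) 0 1) : HasContr p V (W * W') (fun _ => 0) 0 1 :=
  (h.mul_right h').congr (fun _ => add_zero _) (add_zero _) (mul_one _)

/-- Covers every exponential occurring in `X_i^±` with `i ≥ 2`, including the two `Z_n` factors at
`i = n`. -/
theorem qcomm_phiZ_current_eq_zero [CharZero K] (hp0 : p ≠ 0) (hp : ∀ k : ℕ, 0 < k → p ^ k ≠ 1)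
    (hn : 2 ≤ n) {i j l : ℕ} (hi : 2 ≤ i) (hin : i ≤ n) (hj : 2 ≤ j) (hl : 2 ≤ l) (μ : Fin n → ℚ)
    (y x x' : ℚ) (s t t' : ℤ) :
    qcomm 1 ((phiZ p n μ y).series p) ((Z p n j t x * Z p n l t' x' * Y p n i s).series p) = 0 :=
  qcomm_one_eq_zero
    (((hasContr_phiZ_Z (by omega) μ y t x).trivial_mul_right
      (hasContr_phiZ_Z (by omega) μ y t' x')).trivial_mul_right
      (hasContr_phiZ_Y hp0 hp hn hi hin μ y s))
    (((hasContr_Z_phiZ (by omega) μ y t x).trivial_mul_left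
      (hasContr_Z_phiZ (by omega) μ y t' x')).trivial_mul_left
      (hasContr_Y_phiZ hp0 hp hn hi hin μ y s))

theorem expZ_log_ratio [CharZero K] {c : ℕ+ → K} {a b : K} (hb : b ≠ 0)
    (hc : ∀ k, c k = (b ^ (k : ℕ) - a ^ (k : ℕ)) / ((k : ℕ) : K)) (m : ℤ) :
    expZ K c m = if m < 0 then 0 else if m = 0 then 1 else b ^ m * (1 - a / b) := by
  split_ifs with h h'
  · exact expZ_of_neg _ h
  · rw [h']
    exact (expZ_natCast c 0).trans (expCoeff_zero c)
  · lift m to ℕ using not_lt.mp h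
    rw [expZ_natCast, expCoeff_log_ratio hc, if_neg (by exact_mod_cast h')]
    obtain ⟨m, rfl⟩ := Nat.exists_eq_succ_of_ne_zero (show m ≠ 0 by exact_mod_cast h')
    rw [Nat.succ_sub_one, zpow_natCast, pow_succ]
    field_simp

end NExp

/-! ### Commutators with the summands of `X_1^+` and `X_1^-`. -/

namespace NExp

variable {n : ℕ} {K : Type*} [Field K] {p : K}

/-- The summands of `X_1^+(z)`. -/
def plusTerm (p : K) (n : ℕ) (x : ℚ) : NExp n K := Z p n 1 1 x * Z p n 2 (-1) 0 * Y p n 1 1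

/-- The summands of `X_1^-(z)`. -/
def minusTerm (p : K) (n : ℕ) (x : ℚ) : NExp n K := Z p n 1 (-1) 0 * Z p n 2 1 x * Y p n 1 (-1)

theorem exists_quarter {y : ℚ} (hy : ∃ m : ℤ, 4 * y = m) : ∃ m : ℤ, 4 * ((n : ℚ) + 1 / 2 + y) = m := by
  obtain ⟨m, hm⟩ := hy
  exact ⟨4 * n + 2 + m, by push_cast; rw [← hm]; ring⟩

theorem qpow_level_add (hp0 : p ≠ 0) (y : ℚ) :
    qpow p ((n : ℚ) + 1 / 2 + y) = qpow p ((n : ℚ) + 1 / 2) * qpow p y :=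
  qpow_add hp0 ⟨4 * n + 2, by push_cast; ring⟩ y

/-- The pole at `w = uz` comes from `Y_1^+`, the zero from `Z_1^+`; the powers `z^{-1}` and `z` of
the two contractions cancel, and `u^{-1} · u q^y` leaves `q^y`. -/
theorem hasContr_phiZ_plusTerm [CharZero K] (hp0 : p ≠ 0) (hp : ∀ k : ℕ, 0 < k → p ^ k ≠ 1)
    (hn : 2 ≤ n) (μ : Fin n → ℚ) {y x : ℚ} (hy : ∃ m : ℤ, 4 * y = m) (hx : ∃ m : ℤ, 4 * x = m) :
    HasContr p (phiZ p n μ y) (plusTerm p n x)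
      (fun k => ((qpow p (n + 1 / 2))⁻¹ ^ (k : ℕ) -
        (qpow p x * (qpow p (n + 1 / 2) * qpow p y)⁻¹) ^ (k : ℕ)) / ((k : ℕ) : K)) 0 (qpow p y) := by
  have hy' := exists_quarter (n := n) hy
  refine (((((hasContr_phiA_Z μ 1 1 x).mul_right (hasContr_phiA_Z μ 2 (-1) 0)).mul_right
    (hasContr_phiA_Y hp0 hp hn μ le_rfl (by omega) 1)).mul_left
    (((hasContr_Z_Z hp0 (by omega) 1 1 hy' hx).mul_right
      (hasContr_Z_Z_of_ne 1 2 (by omega) 1 (-1) _ 0)).mul_right (hasContr_Z_Y 1 1 1 1 _)))).congr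
    (fun k => ?_) ?_ ?_
  · have e : qpow p (-(n + 3 / 4) + (1 : ℤ) / 4) = (qpow p (n + 1 / 2))⁻¹ := by
      rw [← qpow_neg ⟨4 * n + 2, by push_cast; ring⟩]
      congr 1
      push_cast
      ring
    simp only [if_true, qpow_level_add hp0, e]
    push_cast
    ring
  · norm_num
  · have e : (((n : ℚ) + 1 / 2) * -((1 : ℤ) : ℚ)) = -(n + 1 / 2) := by push_cast; ring
    have e' : (((n : ℚ) + 1 / 2 + y) * (((1 : ℤ) : ℚ) * ((1 : ℤ) : ℚ))) = n + 1 / 2 + y := by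
      push_cast; ring
    rw [if_pos rfl, e, e', qpow_neg ⟨4 * n + 2, by push_cast; ring⟩, qpow_level_add hp0]
    have h := qpow_ne_zero hp0 (n + 1 / 2)
    simp only [one_mul, mul_one]
    rw [inv_mul_cancel_left₀ h]

theorem hasContr_plusTerm_phiZ [CharZero K] (hp0 : p ≠ 0) (hp : ∀ k : ℕ, 0 < k → p ^ k ≠ 1)
    (hn : 2 ≤ n) (μ : Fin n → ℚ) {y x : ℚ} (hy : ∃ m : ℤ, 4 * y = m) (hx : ∃ m : ℤ, 4 * x = m) :
    HasContr p (plusTerm p n x) (phiZ p n μ y)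
      (fun k => ((qpow p (n + 1 / 2)) ^ (k : ℕ) -
        (qpow p (n + 1 / 2) * qpow p y * (qpow p x)⁻¹) ^ (k : ℕ)) / ((k : ℕ) : K)) 0
      (qpow p x) := by
  have hy' := exists_quarter (n := n) hy
  refine (((((hasContr_Z_phiA μ 1 1 x).mul_left (hasContr_Z_phiA μ 2 (-1) 0)).mul_left
    (hasContr_Y_phiA hp0 hp hn μ le_rfl (by omega) 1)).mul_right
    (((hasContr_Z_Z hp0 (by omega) 1 1 hx hy').mul_left
      (hasContr_Z_Z_of_ne 2 1 (by omega) (-1) 1 0 _)).mul_left (hasContr_Y_Z 1 1 1 1 _)))).congr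
    (fun k => ?_) ?_ ?_
  · have e : qpow p (n + 1 / 4 + (1 : ℤ) / 4) = qpow p (n + 1 / 2) := by
      congr 1
      push_cast
      ring
    simp only [if_true, qpow_level_add hp0, e]
    push_cast
    ring
  · norm_num
  · have e : (x * (((1 : ℤ) : ℚ) * ((1 : ℤ) : ℚ))) = x := by push_cast; ring
    rw [e]
    ring

/-- Two expansions of one rational function with a simple pole differ by a delta function, whose
coefficient `b - a` is the numerator at the pole. -/
theorem commFactor_plusTerm [CharZero K] {u a b : K} (hu : u ≠ 0) (ha : a ≠ 0) (hb : b ≠ 0)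
    (m : ℤ) :
    commFactor 1 (fun k => (u⁻¹ ^ (k : ℕ) - (a * (u * b)⁻¹) ^ (k : ℕ)) / ((k : ℕ) : K))
      (fun k => (u ^ (k : ℕ) - (u * b * a⁻¹) ^ (k : ℕ)) / ((k : ℕ) : K)) b a m =
      (b - a) * u⁻¹ ^ m := by
  rw [commFactor, expZ_log_ratio (inv_ne_zero hu) fun _ => rfl, expZ_log_ratio hu fun _ => rfl]
  rcases lt_trichotomy m 0 with hm | rfl | hm
  · rw [if_pos hm, if_neg (by omega), if_neg (by omega), inv_zpow, zpow_neg]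
    field_simp
    ring
  · simp
  · rw [if_neg (by omega), if_neg (by omega), if_pos (by omega)]
    field_simp
    ring

/-- At `w = uz` the shifts enter only through `:Z_1^+(u q^y z) Z_1^+(u q^x z):`, which is symmetric
in `y` and `x`. -/
theorem phiZ_mul_dilate_plusTerm (hp0 : p ≠ 0) (μ : Fin n → ℚ) (y x : ℚ) :
    phiZ p n μ y * (plusTerm p n x).dilate (qpow p (n + 1 / 2)) =
      phiZ p n μ x * (plusTerm p n y).dilate (qpow p (n + 1 / 2)) := by
  have hU : ∃ m : ℤ, 4 * ((n : ℚ) + 1 / 2) = m := ⟨4 * n + 2, by push_cast; ring⟩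
  have hU' : ∀ k : ℤ, ∃ m : ℤ, 4 * (((n : ℚ) + 1 / 2) * k) = m := fun k =>
    ⟨(4 * n + 2) * k, by push_cast; ring⟩
  have h1 : ∀ (y : ℚ) (k : ℤ), qpow p (((n : ℚ) + 1 / 2 + y) * k) =
      qpow p (((n : ℚ) + 1 / 2) * k) * qpow p (y * k) := fun y k => by
    rw [add_mul, qpow_add hp0 (hU' k)]
  have hneg : ∀ (y : ℚ) (k : ℤ), -(y * k) = y * ((-k : ℤ) : ℚ) := fun y k => by push_cast; ring
  have hk : ∀ k : ℕ+, qpow p ((n : ℚ) + 1 / 2) ^ (k : ℕ) = qpow p (((n : ℚ) + 1 / 2) * (k : ℕ)) :=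
    fun k => (qpow_mul_natCast hU _).symm
  have hk' : ∀ k : ℕ+, (qpow p ((n : ℚ) + 1 / 2))⁻¹ ^ (k : ℕ) =
      qpow p (-(((n : ℚ) + 1 / 2) * (k : ℕ))) := fun k => by
    rw [inv_pow, hk, qpow_neg]
    exact hU' k
  refine NExp.ext ?_ ?_ ?_ ?_ rfl rfl ?_ rfl
  · rfl
  · funext k i
    have h1' := fun y => h1 y (k : ℕ)
    simp only [Int.cast_natCast] at h1'
    change ((phiA p n μ).creB k i + (Z p n 1 1 _).creB k i) + _ * (((Z p n 1 1 _).creB k i +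
      (Z p n 2 (-1) 0).creB k i) + (Y p n 1 1).creB k i) = ((phiA p n μ).creB k i +
      (Z p n 1 1 _).creB k i) + _ * (((Z p n 1 1 _).creB k i +
      (Z p n 2 (-1) 0).creB k i) + (Y p n 1 1).creB k i)
    simp only [hk, Z, h1']
    split_ifs <;> ring
  · rfl
  · funext k i
    have h1' := fun y => h1 y (-(k : ℕ))
    simp only [← hneg, Int.cast_natCast] at h1'
    change ((phiA p n μ).annB k i + (Z p n 1 1 _).annB k i) + _ * (((Z p n 1 1 _).annB k i +
      (Z p n 2 (-1) 0).annB k i) + (Y p n 1 1).annB k i) = ((phiA p n μ).annB k i +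
      (Z p n 1 1 _).annB k i) + _ * (((Z p n 1 1 _).annB k i +
      (Z p n 2 (-1) 0).annB k i) + (Y p n 1 1).annB k i)
    simp only [hk', Z, h1']
    split_ifs <;> ring
  · funext w
    -- `b_1(0)` has integer eigenvalues because `β ∈ P`; this is what permits splitting the exponent
    -- of `q`.
    obtain ⟨b, hb⟩ : ∃ b : ℤ, ((1 : ℤ) : ℚ) * (2 * form (toRat (eps n 1)) w.be) = b := by
      refine ⟨∑ i, eps n 1 i * w.2.2 i, ?_⟩
      simp only [form, Charge.be, toRat, Finset.mul_sum]
      push_cast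
      exact Finset.sum_congr rfl fun i _ => by ring
    change ((phiA p n μ).scal w * (Z p n 1 1 _).scal w) * (((Z p n 1 1 _).scal w *
      (Z p n 2 (-1) 0).scal w) * (Y p n 1 1).scal w) = ((phiA p n μ).scal w * (Z p n 1 1 _).scal w)
      * (((Z p n 1 1 _).scal w * (Z p n 2 (-1) 0).scal w) * (Y p n 1 1).scal w)
    simp only [Z, hb, h1]
    ring

theorem qcomm_phiZ_plusTerm_same [CharZero K] (hp0 : p ≠ 0) (hp : ∀ k : ℕ, 0 < k → p ^ k ≠ 1)
    (hn : 2 ≤ n) (μ : Fin n → ℚ) {y : ℚ} (hy : ∃ m : ℤ, 4 * y = m) (r s : ℚ) :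
    qcomm 1 ((phiZ p n μ y).series p) ((plusTerm p n y).series p) r s = 0 := by
  rw [qcomm_eq_smul_qcomm (hasContr_phiZ_plusTerm hp0 hp hn μ hy hy)
    (hasContr_plusTerm_phiZ hp0 hp hn μ hy hy) (v' := 1) (x := 0), zero_smul]
  intro m
  rw [commFactor_plusTerm (qpow_ne_zero hp0 _) (qpow_ne_zero hp0 _) (qpow_ne_zero hp0 _), sub_self,
    zero_mul, zero_mul]

theorem qcomm_phiZ_plusTerm_swap [CharZero K] (hp0 : p ≠ 0) (hp : ∀ k : ℕ, 0 < k → p ^ k ≠ 1)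
    (hn : 2 ≤ n) (μ : Fin n → ℚ) {y x : ℚ} (hy : ∃ m : ℤ, 4 * y = m) (hx : ∃ m : ℤ, 4 * x = m)
    (r s : ℚ) :
    qcomm 1 ((phiZ p n μ y).series p) ((plusTerm p n x).series p) r s +
      qcomm 1 ((phiZ p n μ x).series p) ((plusTerm p n y).series p) r s = 0 := by
  refine qcomm_add_qcomm_eq_zero (hasContr_phiZ_plusTerm hp0 hp hn μ hy hx)
    (hasContr_plusTerm_phiZ hp0 hp hn μ hy hx) (hasContr_phiZ_plusTerm hp0 hp hn μ hx hy)
    (hasContr_plusTerm_phiZ hp0 hp hn μ hx hy) (u := qpow p (n + 1 / 2))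
    (x := qpow p y - qpow p x) (qpow_ne_zero hp0 _) (fun m => ?_) (fun m => ?_) rfl rfl
    (phiZ_mul_dilate_plusTerm hp0 μ y x) r s
  · exact commFactor_plusTerm (qpow_ne_zero hp0 _) (qpow_ne_zero hp0 _) (qpow_ne_zero hp0 _) m
  · rw [neg_sub]
    exact commFactor_plusTerm (qpow_ne_zero hp0 _) (qpow_ne_zero hp0 _) (qpow_ne_zero hp0 _) m

/-- Here `Z_1^-` gives the pole and `Y_1^-` the zero; they coincide, and the mode commutators
vanish, when `y = 1/2`. In the opposite order this happens when `y = -1/2`. -/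
theorem hasContr_phiZ_minusTerm [CharZero K] (hp0 : p ≠ 0) (hp : ∀ k : ℕ, 0 < k → p ^ k ≠ 1)
    (hn : 2 ≤ n) (μ : Fin n → ℚ) {y : ℚ} (hy : ∃ m : ℤ, 4 * y = m) (x : ℚ) :
    HasContr p (phiZ p n μ y) (minusTerm p n x)
      (fun k => ((qpow p (n + 1 / 2) * qpow p y)⁻¹ ^ (k : ℕ) -
        (qpow p (n + 1 / 2) * qpow p (1 / 2))⁻¹ ^ (k : ℕ)) / ((k : ℕ) : K)) 0 (qpow p y)⁻¹ := by
  have hy' := exists_quarter (n := n) hy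
  refine (((((hasContr_phiA_Z μ 1 (-1) 0).mul_right (hasContr_phiA_Z μ 2 1 x)).mul_right
    (hasContr_phiA_Y hp0 hp hn μ le_rfl (by omega) (-1))).mul_left
    (((hasContr_Z_Z hp0 (by omega) 1 (-1) hy' ⟨0, by simp⟩).mul_right
      (hasContr_Z_Z_of_ne 1 2 (by omega) 1 1 _ x)).mul_right (hasContr_Z_Y 1 1 (-1) 1 _)))).congr
    (fun k => ?_) ?_ ?_
  · have e : qpow p (-(n + 3 / 4) + (-1 : ℤ) / 4) = (qpow p (n + 1 / 2) * qpow p (1 / 2))⁻¹ := by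
      rw [← qpow_level_add hp0, ← qpow_neg ⟨4 * n + 4, by push_cast; ring⟩]
      congr 1
      push_cast
      ring
    simp only [if_true, qpow_level_add hp0, e, qpow_zero]
    push_cast
    ring
  · norm_num
  · have e : (((n : ℚ) + 1 / 2) * -((-1 : ℤ) : ℚ)) = n + 1 / 2 := by push_cast; ring
    have e' : (((n : ℚ) + 1 / 2 + y) * (((1 : ℤ) : ℚ) * ((-1 : ℤ) : ℚ))) = -(n + 1 / 2 + y) := by
      push_cast; ring
    rw [if_pos rfl, e, e', qpow_neg hy', qpow_level_add hp0]
    have h := qpow_ne_zero hp0 (n + 1 / 2)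
    simp only [one_mul, mul_one]
    rw [mul_inv, mul_inv_cancel_left₀ h]

theorem hasContr_minusTerm_phiZ [CharZero K] (hp0 : p ≠ 0) (hp : ∀ k : ℕ, 0 < k → p ^ k ≠ 1)
    (hn : 2 ≤ n) (μ : Fin n → ℚ) {y : ℚ} (hy : ∃ m : ℤ, 4 * y = m) (x : ℚ) :
    HasContr p (minusTerm p n x) (phiZ p n μ y)
      (fun k => ((qpow p (n + 1 / 2) * qpow p y) ^ (k : ℕ) -
        (qpow p (n + 1 / 2) * (qpow p (1 / 2))⁻¹) ^ (k : ℕ)) / ((k : ℕ) : K)) 0 1 := by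
  have hy' := exists_quarter (n := n) hy
  refine (((((hasContr_Z_phiA μ 1 (-1) 0).mul_left (hasContr_Z_phiA μ 2 1 x)).mul_left
    (hasContr_Y_phiA hp0 hp hn μ le_rfl (by omega) (-1))).mul_right
    (((hasContr_Z_Z hp0 (by omega) (-1) 1 ⟨0, by simp⟩ hy').mul_left
      (hasContr_Z_Z_of_ne 2 1 (by omega) 1 1 x _)).mul_left (hasContr_Y_Z 1 1 (-1) 1 _)))).congr
    (fun k => ?_) ?_ ?_
  · have e : qpow p (n + 1 / 4 + (-1 : ℤ) / 4) = qpow p (n + 1 / 2) * (qpow p (1 / 2))⁻¹ := by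
      rw [← qpow_neg ⟨2, by norm_num⟩, ← qpow_level_add hp0]
      congr 1
      push_cast
      ring
    simp only [if_true, qpow_level_add hp0, e, qpow_zero]
    push_cast
    ring
  · norm_num
  · simp [qpow_zero]

/-- With `h = q^{1/2}` and `s = z/w`: for `a = h` the factors for `v = h⁻¹` and `v = h` are `u
h⁻¹(h⁻¹ - h)s` and `h⁻¹ - h`, both over `1 - uhs`. For `a = h⁻¹` they are `h - h⁻¹` and `(h/u)(h -
h⁻¹)s⁻¹`, both over `1 - (h/u)s⁻¹`. In both cases the ratio is `u h⁻¹ s`. -/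
theorem commFactor_minusTerm [CharZero K] {u h a : K} (hu : u ≠ 0) (hh : h ≠ 0)
    (ha : a = h ∨ a = h⁻¹) (m : ℤ) :
    commFactor h⁻¹ (fun k => ((u * a)⁻¹ ^ (k : ℕ) - (u * h)⁻¹ ^ (k : ℕ)) / ((k : ℕ) : K))
      (fun k => ((u * a) ^ (k : ℕ) - (u * h⁻¹) ^ (k : ℕ)) / ((k : ℕ) : K)) a⁻¹ 1 m =
      u * h⁻¹ * commFactor h
        (fun k => ((u * a)⁻¹ ^ (k : ℕ) - (u * h)⁻¹ ^ (k : ℕ)) / ((k : ℕ) : K))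
        (fun k => ((u * a) ^ (k : ℕ) - (u * h⁻¹) ^ (k : ℕ)) / ((k : ℕ) : K)) a⁻¹ 1 (m + 1) := by
  have ha0 : a ≠ 0 := by rcases ha with rfl | rfl <;> simp [hh]
  have hua : u * a ≠ 0 := mul_ne_zero hu ha0
  simp only [commFactor, expZ_log_ratio (inv_ne_zero hua) fun _ => rfl,
    expZ_log_ratio hua fun _ => rfl]
  have hz : (u * a)⁻¹ ^ (m + 1) = (u * a)⁻¹ ^ m * (u * a)⁻¹ := zpow_add_one₀ (inv_ne_zero hua) m
  have hz' : (u * a) ^ (-(m + 1)) = (u * a)⁻¹ ^ m * (u * a)⁻¹ := by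
    rw [← hz, inv_zpow, zpow_neg]
  have hz'' : (u * a) ^ (-m) = (u * a)⁻¹ ^ m := by rw [inv_zpow, zpow_neg]
  rw [hz, hz', hz'']
  rcases lt_trichotomy m 0 with hm | rfl | hm
  -- The values `m = -1` and `m = 0` are separate because there `m + 1` or `m` meets the constant
  -- term, which is `1` and does not follow the geometric pattern.
  · rcases eq_or_lt_of_le (show m ≤ -1 by omega) with rfl | hm'
    · rcases ha with rfl | rfl <;> (norm_num; field_simp; first | ring1 | simp)
    · rw [if_pos hm, if_pos (show m + 1 < 0 by omega), if_neg (show ¬ -m < 0 by omega),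
        if_neg (show ¬ -m = 0 by omega), if_neg (show ¬ -(m + 1) < 0 by omega),
        if_neg (show ¬ -(m + 1) = 0 by omega)]
      rcases ha with rfl | rfl <;> field_simp <;> ring
  · rcases ha with rfl | rfl <;> norm_num <;> field_simp <;> simp
  · rw [if_neg (show ¬ m < 0 by omega), if_neg (show ¬ m = 0 by omega),
      if_neg (show ¬ m + 1 < 0 by omega), if_neg (show ¬ m + 1 = 0 by omega),
      if_pos (show -m < 0 by omega), if_pos (show -(m + 1) < 0 by omega)]
    rcases ha with rfl | rfl <;> field_simp <;> ring

theorem qcomm_phiZ_minusTerm [CharZero K] (hp0 : p ≠ 0) (hp : ∀ k : ℕ, 0 < k → p ^ k ≠ 1)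
    (hn : 2 ≤ n) (μ : Fin n → ℚ) {y : ℚ} (hy : y = 1 / 2 ∨ y = -1 / 2) (x r s : ℚ) :
    qcomm (qpow p (-1 / 2)) ((phiZ p n μ y).series p) ((minusTerm p n x).series p) r s =
      qpow p n • qcomm (qpow p (1 / 2)) ((phiZ p n μ y).series p) ((minusTerm p n x).series p)
        (r - 1) (s + 1) := by
  have hy' : ∃ m : ℤ, 4 * y = m := by
    rcases hy with rfl | rfl
    · exact ⟨2, by norm_num⟩
    · exact ⟨-2, by norm_num⟩
  have hh : qpow p (-1 / 2) = (qpow p (1 / 2))⁻¹ := by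
    rw [← qpow_neg ⟨2, by norm_num⟩]
    norm_num
  have hqn : qpow p n = qpow p (n + 1 / 2) * (qpow p (1 / 2))⁻¹ := by
    rw [← hh, ← qpow_level_add hp0]
    congr 1
    ring
  refine qcomm_eq_smul_qcomm (hasContr_phiZ_minusTerm hp0 hp hn μ hy' x)
    (hasContr_minusTerm_phiZ hp0 hp hn μ hy' x) (fun m => ?_) r s
  rw [hh, hqn]
  refine commFactor_minusTerm (qpow_ne_zero hp0 _) (qpow_ne_zero hp0 _) ?_ m
  rcases hy with rfl | rfl
  · exact Or.inl rfl
  · exact Or.inr hh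

end NExp

/-! ### Assembly of the relations for the currents. -/

section Main

open NExp

variable {n : ℕ} {K : Type*} [Field K] {p : K}

theorem smul_zero_sub_zero {M : Type*} [AddCommGroup M] [Module K M] (x : K) :
    x • ((0 : M) - 0) = 0 := by
  simp

theorem smul_zero_sub_zero' {M : Type*} [AddCommGroup M] [Module K M] (x : K) :
    x • (0 : M) - 0 = 0 := by
  simp

/-- The shape of the double `q`-difference in `[Φ, X_1^+]`: the zeros are the diagonal terms, `A`
and `B` the mixed ones. -/
theorem smul_antisymm_sum {M : Type*} [AddCommGroup M] [Module K M] (x y : K) {A B : M}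
    (h : A + B = 0) : x • y • (y • (0 - A) - y • (B - 0)) = 0 := by
  rw [← smul_sub, show 0 - A - (B - 0) = -(A + B) by abel, h]
  simp

theorem smul_smul_zero_sub_zero {M : Type*} [AddCommGroup M] [Module K M] (x y : K) :
    x • y • ((0 : M) - 0) = 0 := by
  simp

theorem smul_smul_smul_sub_comm {M : Type*} [AddCommGroup M] [Module K M] (x y t : K) (A B : M) :
    x • y • (t • A - t • B) = t • x • y • (A - B) := by
  rw [← smul_sub, smul_comm y t, smul_comm x t]

theorem smul_smul_sub_comm {M : Type*} [AddCommGroup M] [Module K M] (x t : K) (A B : M) :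
    x • (t • A - t • B) = t • x • (A - B) := by
  rw [← smul_sub, smul_comm]

theorem qcomm_PhiBar1 (v : K) (ι : Fin 4) (c : K) (B : Series n K) (r s : ℚ) :
    qcomm v (PhiBar1 p n ι c) B r s = c • ((qpow p (1 / 2) - qpow p (-1 / 2)) * qpow p 0)⁻¹ •
      (qcomm v ((phiZ p n (mu n ι) (1 / 2)).series p) B (r + 1) s -
        qcomm v ((phiZ p n (mu n ι) (-1 / 2)).series p) B (r + 1) s) := by
  rw [PhiBar1, qcomm_smul_left, qcomm_qdiff_left, zero_add, zero_sub, ← neg_div]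
  rfl

theorem qcomm_PhiBar1_eq_zero (ι : Fin 4) (c : K) (B : Series n K)
    (h : ∀ y, qcomm 1 ((phiZ p n (mu n ι) y).series p) B = 0) :
    qcomm 1 (PhiBar1 p n ι c) B = 0 := by
  funext r s
  rw [qcomm_PhiBar1, h, h]
  exact smul_smul_zero_sub_zero (M := Module.End K (Fock n K)) c _

theorem qcomm_qdiff_eq_zero (v : K) (A : Series n K) (G : ℚ → Series n K)
    (h : ∀ y, qcomm v A (G y) = 0) (y : ℚ) : qcomm v A (qdiff p G y) = 0 := by
  funext r s
  rw [qcomm_qdiff_right, h, h]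
  exact smul_zero_sub_zero (M := Module.End K (Fock n K)) _

theorem Xplus_one (hn : 2 ≤ n) :
    Xplus p n 1 = qdiff p (fun x => (plusTerm p n x).series p) 0 := by
  rw [Xplus, if_pos (by omega)]
  rfl

theorem Xminus_one (hn : 2 ≤ n) :
    Xminus p n 1 = qdiff p (fun x => (minusTerm p n x).series p) 0 := by
  rw [Xminus, if_pos (by omega)]
  rfl

variable [CharZero K] (hp0 : p ≠ 0) (hp : ∀ k : ℕ, 0 < k → p ^ k ≠ 1) (hn : 2 ≤ n)

include hp0 hp hn

theorem qcomm_PhiBar1_Xplus_one (ι : Fin 4) (c : K) :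
    qcomm 1 (PhiBar1 p n ι c) (Xplus p n 1) = 0 := by
  have h4 : ∃ m : ℤ, 4 * (1 / 2 : ℚ) = m := ⟨2, by norm_num⟩
  have h4' : ∃ m : ℤ, 4 * (-1 / 2 : ℚ) = m := ⟨-2, by norm_num⟩
  funext r s
  rw [qcomm_PhiBar1, Xplus_one hn, qcomm_qdiff_right, qcomm_qdiff_right, zero_add, zero_sub,
    ← neg_div, qcomm_phiZ_plusTerm_same hp0 hp hn _ h4, qcomm_phiZ_plusTerm_same hp0 hp hn _ h4']
  exact smul_antisymm_sum (M := Module.End K (Fock n K)) c _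
    (qcomm_phiZ_plusTerm_swap hp0 hp hn (mu n ι) h4 h4' (r + 1) (s + 1))

theorem qcomm_PhiBar1_Xplus (ι : Fin 4) (c : K) {i : ℕ} (hi : 1 ≤ i) (hin : i ≤ n) :
    qcomm 1 (PhiBar1 p n ι c) (Xplus p n i) = 0 := by
  rcases eq_or_lt_of_le hi with rfl | hi2
  · exact qcomm_PhiBar1_Xplus_one hp0 hp hn ι c
  refine qcomm_PhiBar1_eq_zero ι c _ fun y => ?_
  rw [Xplus]
  split_ifs with h
  · exact qcomm_qdiff_eq_zero _ _ _ (fun x => qcomm_phiZ_current_eq_zero hp0 hp hn hi2 hin hi2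
      (by omega) _ _ _ _ _ _ _) _
  · have key : ∀ x x' : ℚ, qcomm 1 ((phiZ p n (mu n ι) y).series p)
        ((Z p n n 1 x * Z p n n 1 x' * Y p n n 1).series p) = 0 := fun x x' =>
      qcomm_phiZ_current_eq_zero hp0 hp hn hn le_rfl hn hn _ _ _ _ _ _ _
    funext r s
    rw [qcomm_sub_right, qcomm_smul_right,
      qcomm_qdiff_eq_zero _ _ _ (qcomm_qdiff_eq_zero _ _ _ fun x => key 0 x),
      qcomm_qdiff_eq_zero _ _ _ fun x => qcomm_qdiff_eq_zero _ _ _ (fun x' => key x x') _]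
    exact smul_zero_sub_zero' (M := Module.End K (Fock n K)) _

theorem qcomm_PhiBar1_Xminus (ι : Fin 4) (c : K) {i : ℕ} (hi : 2 ≤ i) (hin : i ≤ n) :
    qcomm 1 (PhiBar1 p n ι c) (Xminus p n i) = 0 := by
  refine qcomm_PhiBar1_eq_zero ι c _ fun y => ?_
  rw [Xminus]
  split_ifs with h
  · exact qcomm_qdiff_eq_zero _ _ _ (fun x => qcomm_phiZ_current_eq_zero hp0 hp hn hi hin hi
      (by omega) _ _ _ _ _ _ _) _
  · funext r s
    rw [qcomm_smul_right, qcomm_phiZ_current_eq_zero hp0 hp hn hn le_rfl hn hn]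
    simp

theorem qcomm_PhiBar1_Xminus_one (ι : Fin 4) (c : K) :
    qcomm (qpow p (-1 / 2)) (PhiBar1 p n ι c) (Xminus p n 1) =
      qpow p n • mulZdivW (qcomm (qpow p (1 / 2)) (PhiBar1 p n ι c) (Xminus p n 1)) := by
  have key : ∀ y : ℚ, y = 1 / 2 ∨ y = -1 / 2 → ∀ r s : ℚ,
      qcomm (qpow p (-1 / 2)) ((phiZ p n (mu n ι) y).series p) (Xminus p n 1) r s =
        qpow p n • qcomm (qpow p (1 / 2)) ((phiZ p n (mu n ι) y).series p) (Xminus p n 1)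
          (r - 1) (s + 1) := by
    intro y hy r s
    rw [Xminus_one hn, qcomm_qdiff_right, qcomm_qdiff_right, qcomm_phiZ_minusTerm hp0 hp hn _ hy,
      qcomm_phiZ_minusTerm hp0 hp hn _ hy]
    exact smul_smul_sub_comm (M := Module.End K (Fock n K)) _ _ _ _
  funext r s
  change _ = qpow p n • qcomm (qpow p (1 / 2)) (PhiBar1 p n ι c) (Xminus p n 1) (r - 1) (s + 1)
  -- The factor `1/z` in `∂` raises the exponent by one, which commutes with the shift by `z/w`.
  rw [qcomm_PhiBar1, qcomm_PhiBar1, key _ (Or.inl rfl), key _ (Or.inr rfl), add_sub_right_comm]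
  exact smul_smul_smul_sub_comm (M := Module.End K (Fock n K)) _ _ _ _ _

end Main

end

end SpVertex


theorem mainTheorem5 {K : Type*} [Field K] [CharZero K] (p : K) (hp0 : p ≠ 0)
    (hp : ∀ k : ℕ, 0 < k → p ^ k ≠ 1) (n : ℕ) (hn : 2 ≤ n) (ι : Fin 4) (c : K) :
    (∀ i : ℕ, 1 ≤ i → i ≤ n →
      SpVertex.qcomm 1 (SpVertex.PhiBar1 p n ι c) (SpVertex.Xplus p n i) = 0) ∧
    (∀ i : ℕ, 2 ≤ i → i ≤ n →
      SpVertex.qcomm 1 (SpVertex.PhiBar1 p n ι c) (SpVertex.Xminus p n i) = 0) ∧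
    (SpVertex.qcomm (SpVertex.qpow p (-1 / 2)) (SpVertex.PhiBar1 p n ι c)
        (SpVertex.Xminus p n 1) =
      SpVertex.qpow p n • SpVertex.mulZdivW
        (SpVertex.qcomm (SpVertex.qpow p (1 / 2)) (SpVertex.PhiBar1 p n ι c)
          (SpVertex.Xminus p n 1))) ∧
    (∀ r : ℚ,
      SpVertex.PhiBar1 p n ι c r * SpVertex.mode (SpVertex.Xminus p n 1) 1 -
          SpVertex.qpow p (-1 / 2) •
            (SpVertex.mode (SpVertex.Xminus p n 1) 1 * SpVertex.PhiBar1 p n ι c r) =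
        SpVertex.qpow p n •
          (SpVertex.PhiBar1 p n ι c (r - 1) * SpVertex.mode (SpVertex.Xminus p n 1) 0 -
            SpVertex.qpow p (1 / 2) •
              (SpVertex.mode (SpVertex.Xminus p n 1) 0 * SpVertex.PhiBar1 p n ι c (r - 1)))) := by
  have h3 := SpVertex.qcomm_PhiBar1_Xminus_one hp0 hp hn ι c
  refine ⟨fun i hi hin => SpVertex.qcomm_PhiBar1_Xplus hp0 hp hn ι c hi hin,
    fun i hi hin => SpVertex.qcomm_PhiBar1_Xminus hp0 hp hn ι c hi hin, h3, fun r => ?_⟩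
  -- The mode relation is the coefficient of `w^{-2}`: this selects `x_1^-(1)` on the left, and the
  -- factor `z/w` selects the coefficient of `w^{-1}`, that is `x_1^-(0)`, on the right.
  have h4 := congrFun (congrFun h3 r) (-((1 : ℤ) : ℚ) - 1)
  have e : -((1 : ℤ) : ℚ) - 1 + 1 = -((0 : ℤ) : ℚ) - 1 := by norm_num
  simp only [Pi.smul_apply, SpVertex.mulZdivW, e] at h4
  exact h4
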